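/- \textbf{Exact reduced dynamics under non-$\pi$ pulses.} \emph{Setting.} Let $(\Omega,P)$ be a probability space (classical ensemble), $H$ the Hilbert space of a bath, $\rho_B=\sum_k p_k|\psi_k\rangle\langle\psi_k|$ a density operator on $H$, and $B(t)$, $t\in\mathbb R$, (random, possibly unbounded) symmetric operators on a common dense invariant domain $D$ of $L^2(\Omega,P;H)$ containing the constant vectors $\psi_k$. Write $\langle X\rangle$ for the classical average of $\mathrm{Tr}_B(X\rho_B)$, i.e. $\langle X\rangle=\sum_k p_k\langle\psi_k,X\psi_k\rangle_{L^2(\Omega;H)}$. Products of the $B(t)$ have finite second moments, and the noise is zero-mean, stationary ($\langle B(t)B(t')\rangle=\langle B(t-t')B(0)\rangle$), Gaussian (all ordered moments $\langle B(t_1)\cdots B(t_n)\rangle$ are given by Wick's formula in terms of the two-point function) and has a continuous correlation function $\tau\mapsto\langle B(\tau)B(0)\rangle$. Put $C^\pm(t,t')=\langle B(t)B(t')\pm B(t')B(t)\rangle$. A qubit is coupled to the bath by $\sigma_z\otimes B(t)$ and controlled by finitely many instantaneous $\pi$ pulses about $\sigma_y$, with control propagator $U^\pi_{\rm ctrl}(t)$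 and switching function $y(t)=\pm1$ changing sign at each of them, and by rotations $[\theta_j]_y=e^{-i\theta_j\sigma_y/2}$ at times $0=t_0<t_1<\dots<t_N=T$. Let $U_\varepsilon(s,t)$, $\varepsilon=\pm1$, be the time-ordered exponential $\mathcal T_+\exp[-i\int_s^t\varepsilon y(u)\sigma_z\otimes B(u)\,du]$ (evolution from $s$ to $t$), assumed to be well defined, i.e. to be the unique unitary propagator on $[0,T]$ solving the Schr\"odinger equation weakly on $D$. The propagator in the toggling frame is $$U(T)=[\theta_N]_yU_+(t_{N-1},t_N)[\theta_{N-1}]_y\cdots[\theta_1]_yU_+(t_0,t_1)[\theta_0]_y .$$ For $r\in\{0,1\}^{N+1}$ let $|r|_k=\sum_{j\ge k}r_j$, let $U_r(T)=\bar U(t_{N-1},t_N)\cdots\bar U(t_0,t_1)$ with $\bar U(t_{k-1},t_k)=U_{(-1)^{|r|_k}}(t_{k-1},t_k)$, and let $y_r(t)=(-1)^{|r|_k}y(t)$ for $t\in[t_{k-1},t_k)$ (and $k=N$ at $t=T$). For $o,\alpha\in\{x,y,z\}$ let $f_o^\alpha=\frac12\mathrm{Tr}(\sigma_o\sigma_\alpha\sigma_o\sigma_\alpha)$,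 and put $c^{(j)}_{r}=\cos(\theta_j/2+r\pi/2)$ and $$Y^{\pm}(t)=\tfrac12\big(y_r(t)\pm f_o^z\,y_{r'}(t)\big),$$ $$I^+_{r,r'}=\int_0^T\!dt\int_0^T\!dt'\,Y^-(t)Y^-(t')C^+(t,t'),\qquad I^-_{r,r'}=\int_0^T\!dt\int_0^t\!dt'\,Y^-(t)Y^+(t')C^-(t,t'),$$ $$v_{o,r,r'}=\exp\!\big(-I^+_{r,r'}-2i\,\mathrm{Im}\,I^-_{r,r'}\big).$$ (For $o=x,y$ one has $f_o^z=-1$.) Let $V_o(T)=\langle\sigma_o^{-1}U(T)^\dagger\sigma_oU(T)\rangle$ and $V_{o,r,r'}=\langle\sigma_o^{-1}U_{r'}(T)^\dagger\sigma_oU_r(T)\rangle$, where $\langle\cdot\rangle$ acts on the bath factor only. \emph{Claim.} \begin{enumerate} \item $U^\pi_{\rm ctrl}(t)^\dagger\sigma_zU^\pi_{\rm ctrl}(t)=y(t)\sigma_z$ and $U^\pi_{\rm ctrl}(t)^\dagger[\theta]_yU^\pi_{\rm ctrl}(t)=[\theta]_y$ for all $t,\theta$. \item $U(T)=\sum_r\big(\prod_jc^{(j)}_{r_j}\big)\,i^{|r|_0}\,U_r(T)\,\sigma_y^{|r|_0}$.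 \item For every $o$, $V_o(T)=\sum_{r,r'}i^{|r|_0-|r'|_0}\prod_jc^{(j)}_{r'_j}c^{(j)}_{r_j}\,(f_o^y)^{|r'|_0}\,\sigma_y^{|r'|_0}V_{o,r,r'}\sigma_y^{|r|_0}$. \item For all $o,r,r'$, the operator $\sigma_o^{-1}U_{r'}(T)^\dagger\sigma_oU_r(T)$ is the evolution from $-T$ to $T$ of a unitary propagator of the effective dephasing Hamiltonian $H_{o,r,r'}(t)$ on $[-T,T]$, equal to $-y_{r'}(T-t)\,\sigma_o^{-1}\sigma_z\sigma_o\otimes B(T-t)$ for $0<t\le T$ and to $y_r(T+t)\,\sigma_z\otimes B(T+t)$ for $-T\le t\le0$. The second-order cumulant truncation is exact: with $\mathcal C^{(1)}=\int_{-T}^T\langle H_{o,r,r'}(t)\rangle dt$ and $\mathcal C^{(2)}=2\int_{-T}^Tdt\int_{-T}^tdt'\langle H_{o,r,r'}(t)H_{o,r,r'}(t')\rangle-(\mathcal C^{(1)})^2$, $$V_{o,r,r'}=\exp\!\big[-i\,\mathcal C^{(1)}-\tfrac12\mathcal C^{(2)}\big],$$ $$\mathcal C^{(1)}=2\sigma_z\int_0^TY^-(t)\langle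 B(t)\rangle dt=0,\qquad \mathcal C^{(2)}=(2I^+_{r,r'}+4I^-_{r,r'})\,I_S .$$ Moreover $I^+_{r,r'}$ is real, $I^-_{r,r'}$ is purely imaginary, and $V_{o,r,r'}=v_{o,r,r'}\,I_S$. \item For all $o,r,r'$ and all $t\in[0,T]$: $Y^\pm(t)\in\{-1,0,1\}$, $|Y^+(t)+Y^-(t)|=1$ and $Y^+(t)Y^-(t)=0$. \item For every qubit density matrix $\rho_S$, with $\rho_S(T)=\mathrm{Tr}_B[U(T)(\rho_S\otimes\rho_B)U(T)^\dagger]$ (classically averaged) and $E_o=\mathrm{Tr}[\rho_S(T)\sigma_o]$, $$E_o=\mathrm{Tr}[V_o(T)\rho_S\sigma_o]=\sum_{r,r'}i^{|r|_0-|r'|_0}\prod_jc^{(j)}_{r'_j}c^{(j)}_{r_j}\,(f_o^y)^{|r'|_0}\,\mathrm{Tr}\big[\sigma_y^{|r'|_0}\sigma_y^{|r|_0}\rho_S\sigma_o\big]\,v_{o,r,r'},$$ and $\rho_S(T)=\frac12\big(I_S+\sum_{o}E_o\,\sigma_o\big)$. Thus the reduced dynamics is a finite linear combination of the functions $v_{o,r,r'}$.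 \end{enumerate} -/

import Mathlib

open MeasureTheory Complex
open scoped InnerProductSpace Matrix ComplexOrder

noncomputable section

namespace Dephasing

/-! ### The qubit -/

/-- The three axes of the Bloch sphere. -/
inductive Axis where
  | x
  | y
  | z

/-- Pauli matrices. -/
def pauli : Axis → Matrix (Fin 2) (Fin 2) ℂ
  | Axis.x => !![0, 1; 1, 0]
  | Axis.y => !![0, -I; I, 0]
  | Axis.z => !![1, 0; 0, -1]

/-- The sign `f_o^α = Tr (σ_o σ_α σ_o σ_α) / 2`, so that `σ_o⁻¹ σ_α σ_o = f_o^α σ_α`. -/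
def pauliSign (o α : Axis) : ℝ :=
  ((pauli o * pauli α * pauli o * pauli α).trace).re / 2

/-- The instantaneous rotation `[θ]_y = exp (- i (θ / 2) σ_y)`. -/
def yRotation (θ : ℝ) : Matrix (Fin 2) (Fin 2) ℂ :=
  NormedSpace.exp ((-I * ((θ / 2 : ℝ) : ℂ)) • pauli Axis.y)

/-- The coefficients `c_r = cos (θ / 2 + r π / 2)` of `[θ]_y = c_0 + c_1 (i σ_y)`. -/
def rotCoeff (θ : ℝ) (r : Fin 2) : ℝ :=
  Real.cos (θ / 2 + ((r : ℕ) : ℝ) * (Real.pi / 2))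

/-- The control propagator `U_ctrl^π(t)` of the π pulses at the times in `P`. -/
def piControl (P : Finset ℝ) (t : ℝ) : Matrix (Fin 2) (Fin 2) ℂ :=
  yRotation Real.pi ^ (P.filter (fun τ => τ ≤ t)).card

/-- The switching function generated by the π pulses at the times in `P`: it changes sign at
each pulse. -/
def switching (P : Finset ℝ) (t : ℝ) : ℝ :=
  (-1) ^ (P.filter (fun τ => τ ≤ t)).card

/-! ### Qubit-bath operators and propagators -/

section Operators

variable {E : Type*} [NormedAddCommGroup E] [InnerProductSpace ℂ E]

/-- Bounded operators on `ℂ² ⊗ E`, as `2 × 2` matrices of bounded operators on `E`. -/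
abbrev JointOp (E : Type*) [NormedAddCommGroup E] [InnerProductSpace ℂ E] : Type _ :=
  Matrix (Fin 2) (Fin 2) (E →L[ℂ] E)

/-- The operator `A ⊗ 1` on `ℂ² ⊗ E`. -/
def onQubit (E : Type*) [NormedAddCommGroup E] [InnerProductSpace ℂ E]
    (A : Matrix (Fin 2) (Fin 2) ℂ) : JointOp E :=
  A.map (fun z => z • (1 : E →L[ℂ] E))

/-- The product `X(t₁) X(t₂) ⋯ X(tₙ) φ` of (unbounded) operators with a common invariant domain. -/
def opWord {D : Submodule ℂ E} (X : ℝ → D →ₗ[ℂ] D) : List ℝ → D → D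
  | [], φ => φ
  | t :: l, φ => X t (opWord X l φ)

/-- `U t s` (evolution from time `s` to time `t`, for times in `[a, c]`) is a unitary propagator of
the Hamiltonian `H(t) = A(t) ⊗ X(t)` on `ℂ² ⊗ E`, where `X(t)` is a symmetric operator with
invariant domain `D`: it solves the Schrödinger equation `i ∂ₜ U(t,s) = H(t) U(t,s)`,
`U(s,s) = 1`, in integrated form, tested against vectors of `D`. -/
structure IsPropagator [CompleteSpace E] (D : Submodule ℂ E) (X : ℝ → D →ₗ[ℂ] D)
    (A : ℝ → Matrix (Fin 2) (Fin 2) ℂ) (a c : ℝ) (U : ℝ → ℝ → JointOp E) : Prop where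
  mem_unitary : ∀ s ∈ Set.Icc a c, ∀ t ∈ Set.Icc a c, U t s ∈ unitary (JointOp E)
  self : ∀ t ∈ Set.Icc a c, U t t = 1
  comp : ∀ s ∈ Set.Icc a c, ∀ u ∈ Set.Icc a c, ∀ t ∈ Set.Icc a c, U t u * U u s = U t s
  integrable : ∀ s ∈ Set.Icc a c, ∀ t ∈ Set.Icc a c, ∀ (i j : Fin 2) (φ : D) (χ : E),
    IntervalIntegrable (fun u => ∑ k, A u i k * ⟪(X u φ : E), U u s k j χ⟫_ℂ) volume s t
  schrodinger : ∀ s ∈ Set.Icc a c, ∀ t ∈ Set.Icc a c, ∀ (i j : Fin 2) (φ : D) (χ : E),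
    ⟪(φ : E), U t s i j χ⟫_ℂ
      = (if i = j then ⟪(φ : E), χ⟫_ℂ else 0)
        - I * ∫ u in s..t, ∑ k, A u i k * ⟪(X u φ : E), U u s k j χ⟫_ℂ

/-- `U t s` is the time-ordered exponential `T₊ exp (- i ∫ₛᵗ A(u) ⊗ X(u) du)` for times in `[a, c]`:
the unique unitary propagator of the Hamiltonian `A(t) ⊗ X(t)`. -/
structure IsTimeOrderedExp [CompleteSpace E] (D : Submodule ℂ E) (X : ℝ → D →ₗ[ℂ] D)
    (A : ℝ → Matrix (Fin 2) (Fin 2) ℂ) (a c : ℝ) (U : ℝ → ℝ → JointOp E) : Prop where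
  propagator : IsPropagator D X A a c U
  unique : ∀ U' : ℝ → ℝ → JointOp E, IsPropagator D X A a c U' →
    ∀ s ∈ Set.Icc a c, ∀ t ∈ Set.Icc a c, U' t s = U t s

end Operators

/-! ### The bath -/

/-- The space `L²(Ω, P; H)` of random bath vectors, where `(Ω, P)` is the classical ensemble and `H`
the Hilbert space of the bath. A random operator `X(ω)` on `H` acts on it by
`(X φ)(ω) = X(ω) φ(ω)`, and its inner product includes the classical ensemble average. If there is
no classical randomness, `Ω` is a point. -/
abbrev BathSpace {Ω : Type*} [MeasurableSpace Ω] (P : Measure Ω) (H : Type*)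
    [NormedAddCommGroup H] [InnerProductSpace ℂ H] : Type _ :=
  Lp H 2 P

/-- A bath: a family `B(t)` of (random, possibly unbounded) symmetric operators on a common dense
invariant domain, and a density operator `ρ_B = ∑ₖ pₖ |ψₖ⟩⟨ψₖ|` on `H` (spectral decomposition) with
respect to which all products of the `B(t)` have finite second moments. -/
structure Bath {Ω : Type*} [MeasurableSpace Ω] (P : Measure Ω) [IsProbabilityMeasure P] (H : Type*)
    [NormedAddCommGroup H] [InnerProductSpace ℂ H] (ι : Type*) where
  /-- the common domain -/
  dom : Submodule ℂ (BathSpace P H)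
  dense_dom : Dense (dom : Set (BathSpace P H))
  /-- the bath operators -/
  B : ℝ → dom →ₗ[ℂ] dom
  symmetric : ∀ (t : ℝ) (φ χ : dom),
    ⟪(B t φ : BathSpace P H), (χ : BathSpace P H)⟫_ℂ
      = ⟪(φ : BathSpace P H), (B t χ : BathSpace P H)⟫_ℂ
  /-- the eigenvalues of `ρ_B` -/
  weight : ι → ℝ
  weight_nonneg : ∀ k, 0 ≤ weight k
  weight_sum : HasSum weight 1
  /-- the eigenvectors of `ρ_B` -/
  eigvec : ι → H
  orthonormal : Orthonormal ℂ eigvec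
  eigvec_mem : ∀ k, Lp.const 2 P (eigvec k) ∈ dom
  finite_moments : ∀ l : List ℝ, Summable fun k =>
    weight k * ‖(opWord B l ⟨Lp.const 2 P (eigvec k), eigvec_mem k⟩ : BathSpace P H)‖ ^ 2

/-- Wick's formula (sum over all pairings of products of two-point functions, the order of the
arguments being kept): the first argument is paired with each of the others. -/
def wick (c : ℝ → ℝ → ℂ) : List ℝ → ℂ
  | [] => 1
  | a :: l => ∑ i : Fin l.length, c a (l.get i) * wick c (l.eraseIdx i)
termination_by l => l.length
decreasing_by
  have hi := i.2
  simp [List.length_eraseIdx, hi]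

namespace Bath

variable {Ω : Type*} [MeasurableSpace Ω] {P : Measure Ω} [IsProbabilityMeasure P] {H : Type*}
  [NormedAddCommGroup H] [InnerProductSpace ℂ H] {ι : Type*}

/-- The eigenvector `ψₖ` of `ρ_B` as a (constant) random vector in the domain. -/
def vec (b : Bath P H ι) (k : ι) : b.dom :=
  ⟨Lp.const 2 P (b.eigvec k), b.eigvec_mem k⟩

/-- The expectation `⟨X⟩`, i.e. the classical average of `Tr_B (X ρ_B)`, of a bounded operator. -/
def expect (b : Bath P H ι) (X : BathSpace P H →L[ℂ] BathSpace P H) : ℂ :=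
  ∑' k, (b.weight k : ℂ) * ⟪(b.vec k : BathSpace P H), X (b.vec k : BathSpace P H)⟫_ℂ

/-- The partial expectation `⟨X⟩` of a qubit-bath operator, an operator of the qubit. -/
def reduce (b : Bath P H ι) (X : JointOp (BathSpace P H)) : Matrix (Fin 2) (Fin 2) ℂ :=
  Matrix.of fun i j => b.expect (X i j)

/-- The reduced state `Tr_B [U (ρ_S ⊗ ρ_B) U†]` of the qubit (with classical average), where
`Tr_B |u⟩⟨v| = ⟪v, u⟫`. -/
def reducedState (b : Bath P H ι) (U : JointOp (BathSpace P H)) (ρS : Matrix (Fin 2) (Fin 2) ℂ) :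
    Matrix (Fin 2) (Fin 2) ℂ :=
  Matrix.of fun i j => ∑ c, ∑ d, ρS c d *
    ∑' k, (b.weight k : ℂ) *
      ⟪U j d (b.vec k : BathSpace P H), U i c (b.vec k : BathSpace P H)⟫_ℂ

/-- The moment `⟨B(t₁) ⋯ B(tₙ)⟩`. -/
def moment (b : Bath P H ι) (l : List ℝ) : ℂ :=
  ∑' k, (b.weight k : ℂ) *
    ⟪(b.vec k : BathSpace P H), (opWord b.B l (b.vec k) : BathSpace P H)⟫_ℂ

/-- The noise has zero mean: `⟨B(t)⟩ = 0`. -/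
def IsZeroMean (b : Bath P H ι) : Prop :=
  ∀ t, b.moment [t] = 0

/-- The two-point function `⟨B(t) B(t')⟩`. -/
def corr (b : Bath P H ι) (t t' : ℝ) : ℂ :=
  b.moment [t, t']

/-- The (centred) noise is Gaussian: all its moments are determined by the two-point function
through Wick's formula, i.e. all cumulants but the second vanish. -/
def IsGaussian (b : Bath P H ι) : Prop :=
  ∀ l : List ℝ, b.moment l = wick b.corr l

/-- The noise is stationary: `⟨B(t) B(t')⟩ = ⟨B(t - t') B(0)⟩`. -/
def IsStationary (b : Bath P H ι) : Prop :=
  ∀ t t', b.corr t t' = b.corr (t - t') 0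

/-- The symmetric (classical) correlation `C⁺(t, t') = ⟨B(t) B(t') + B(t') B(t)⟩`. -/
def corrPlus (b : Bath P H ι) (t t' : ℝ) : ℂ :=
  b.corr t t' + b.corr t' t

/-- The antisymmetric (quantum) correlation `C⁻(t, t') = ⟨B(t) B(t') - B(t') B(t)⟩`. -/
def corrMinus (b : Bath P H ι) (t t' : ℝ) : ℂ :=
  b.corr t t' - b.corr t' t

end Bath

/-! ### Non-π pulses and branches -/

/-- `|r|_k = ∑_{j ≥ k} r_j`. -/
def tailWeight {N : ℕ} (r : Fin (N + 1) → Fin 2) (k : Fin (N + 1)) : ℕ :=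
  ∑ j ∈ Finset.univ.filter (fun j => k ≤ j), (r j : ℕ)

/-- The switching function `y` modulated by the branch `r`: for `t` in `[t_{k-1}, t_k)` the indices
`j` with `t < t_j` are `k, …, N`, so the value is `(-1)^{|r|_k} y(t)`; for `t = t_N` it is
`(-1)^{r_N} y(t)`. -/
def branchSwitching {N : ℕ} (tp : Fin (N + 1) → ℝ) (y : ℝ → ℝ) (r : Fin (N + 1) → Fin 2)
    (t : ℝ) : ℝ :=
  (-1) ^ (∑ j ∈ Finset.univ.filter (fun j => t < tp j ∨ j = Fin.last N), (r j : ℕ)) * y t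

/-- Effective switching function `Y⁺ = (y_r + f_o^z y_{r'}) / 2`. -/
def YPlus {N : ℕ} (tp : Fin (N + 1) → ℝ) (y : ℝ → ℝ) (o : Axis) (r r' : Fin (N + 1) → Fin 2)
    (t : ℝ) : ℝ :=
  (branchSwitching tp y r t + pauliSign o Axis.z * branchSwitching tp y r' t) / 2

/-- Effective switching function `Y⁻ = (y_r - f_o^z y_{r'}) / 2`. -/
def YMinus {N : ℕ} (tp : Fin (N + 1) → ℝ) (y : ℝ → ℝ) (o : Axis) (r r' : Fin (N + 1) → Fin 2)
    (t : ℝ) : ℝ :=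
  (branchSwitching tp y r t - pauliSign o Axis.z * branchSwitching tp y r' t) / 2

section Branches

variable {E : Type*} [NormedAddCommGroup E] [InnerProductSpace ℂ E]

/-- The full propagator
`[θ_N] U(t_{N-1} → t_N) [θ_{N-1}] ⋯ [θ_1] U(t_0 → t_1) [θ_0]`. -/
def totalPropagator {N : ℕ} (tp θ : Fin (N + 1) → ℝ) (U : ℝ → ℝ → JointOp E) : JointOp E :=
  ((List.ofFn fun k : Fin N =>
      onQubit E (yRotation (θ k.succ)) * U (tp k.succ) (tp k.castSucc)).reverse).prod
    * onQubit E (yRotation (θ 0))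

/-- The branch propagator `U_r(T) = Ū(t_{N-1} → t_N) ⋯ Ū(t_0 → t_1)`, where on the `k`-th interval
`Ū` is the propagator for the coupling with sign `(-1)^{|r|_k}`. -/
def branchPropagator {N : ℕ} (tp : Fin (N + 1) → ℝ) (U : ℤˣ → ℝ → ℝ → JointOp E)
    (r : Fin (N + 1) → Fin 2) : JointOp E :=
  ((List.ofFn fun k : Fin N =>
      U ((-1) ^ tailWeight r k.succ) (tp k.succ) (tp k.castSucc)).reverse).prod

/-- `σ_o⁻¹ U'† σ_o U`. -/
def echo [CompleteSpace E] (o : Axis) (U U' : JointOp E) : JointOp E :=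
  onQubit E (pauli o)⁻¹ * star U' * onQubit E (pauli o) * U

end Branches

/-- Qubit factor of the effective Hamiltonian on `[-T, T]`. -/
def effCoupling {N : ℕ} (tp : Fin (N + 1) → ℝ) (y : ℝ → ℝ) (o : Axis)
    (r r' : Fin (N + 1) → Fin 2) (T t : ℝ) : Matrix (Fin 2) (Fin 2) ℂ :=
  if 0 < t then
    ((-branchSwitching tp y r' (T - t) : ℝ) : ℂ) • ((pauli o)⁻¹ * pauli Axis.z * pauli o)
  else ((branchSwitching tp y r (T + t) : ℝ) : ℂ) • pauli Axis.z

/-- The time at which the bath operator enters the effective Hamiltonian on `[-T, T]`. -/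
def effTime (T t : ℝ) : ℝ :=
  if 0 < t then T - t else T + t

namespace Bath

variable {Ω : Type*} [MeasurableSpace Ω] {P : Measure Ω} [IsProbabilityMeasure P] {H : Type*}
  [NormedAddCommGroup H] [InnerProductSpace ℂ H] {ι : Type*}

/-- First cumulant `∫_{-T}^T ⟨H(t)⟩ dt` of the effective Hamiltonian. -/
def cumulantOne (b : Bath P H ι) {N : ℕ} (tp : Fin (N + 1) → ℝ) (y : ℝ → ℝ) (o : Axis)
    (r r' : Fin (N + 1) → Fin 2) (T : ℝ) : Matrix (Fin 2) (Fin 2) ℂ :=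
  Matrix.of fun i j => ∫ t in (-T)..T, effCoupling tp y o r r' T t i j * b.moment [effTime T t]

/-- Second cumulant `2 ∫_{-T}^T dt ∫_{-T}^t dt' ⟨H(t) H(t')⟩ - (first cumulant)²` of the effective
Hamiltonian. -/
def cumulantTwo (b : Bath P H ι) {N : ℕ} (tp : Fin (N + 1) → ℝ) (y : ℝ → ℝ) (o : Axis)
    (r r' : Fin (N + 1) → Fin 2) (T : ℝ) : Matrix (Fin 2) (Fin 2) ℂ :=
  (Matrix.of fun i j => 2 * ∫ t in (-T)..T, ∫ t' in (-T)..t,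
      (effCoupling tp y o r r' T t * effCoupling tp y o r r' T t') i j
        * b.corr (effTime T t) (effTime T t'))
    - b.cumulantOne tp y o r r' T ^ 2

/-- `I⁺ = ∫₀ᵀ dt ∫₀ᵀ dt' Y⁻(t) Y⁻(t') C⁺(t, t')`. -/
def IPlus (b : Bath P H ι) {N : ℕ} (tp : Fin (N + 1) → ℝ) (y : ℝ → ℝ) (o : Axis)
    (r r' : Fin (N + 1) → Fin 2) (T : ℝ) : ℂ :=
  ∫ t in (0 : ℝ)..T, ∫ t' in (0 : ℝ)..T,
    (YMinus tp y o r r' t : ℂ) * (YMinus tp y o r r' t' : ℂ) * b.corrPlus t t'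

/-- `I⁻ = ∫₀ᵀ dt ∫₀ᵗ dt' Y⁻(t) Y⁺(t') C⁻(t, t')`. -/
def IMinus (b : Bath P H ι) {N : ℕ} (tp : Fin (N + 1) → ℝ) (y : ℝ → ℝ) (o : Axis)
    (r r' : Fin (N + 1) → Fin 2) (T : ℝ) : ℂ :=
  ∫ t in (0 : ℝ)..T, ∫ t' in (0 : ℝ)..t,
    (YMinus tp y o r r' t : ℂ) * (YPlus tp y o r r' t' : ℂ) * b.corrMinus t t'

/-- The function `v = exp (- I⁺ - 2 i Im I⁻)`. -/
def vFun (b : Bath P H ι) {N : ℕ} (tp : Fin (N + 1) → ℝ) (y : ℝ → ℝ) (o : Axis)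
    (r r' : Fin (N + 1) → Fin 2) (T : ℝ) : ℂ :=
  Complex.exp (-b.IPlus tp y o r r' T - 2 * I * ((b.IMinus tp y o r r' T).im : ℂ))

end Bath

end Dephasing

end

/-! The algebraic half rests on one symmetry. Conjugation by σ_y reverses σ_z, so σ_y U_{-ε} σ_y
solves the equation that characterises U_ε, and uniqueness of the time-ordered exponential gives σ_y
U_ε = U_{-ε} σ_y (`IsTimeOrderedExp.pauli_y_mul`). Writing each rotation as c₀ + c₁ i σ_y and moving
every σ_y to the right produces the sum over branches (`prod_rotation_eq_sum_branches`); since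
`echo` is sesquilinear, the double sum follows (`echo_sum_smul`).

For a pair of branches, running r forward and then r' backward, conjugated by σ_o, is one single
evolution on [-T, T] (`exists_echo_solution`). Its qubit factor is always a real sign times σ_z, so
each row of the operator matrix evolves with a scalar coupling κ.

The analytic core computes the mean of such an evolution L(t). As the bath operators may be
unbounded and the equation holds only weakly, one follows all the moments F_l(t) = ⟨B(tₙ)⋯B(t₁)
L(t)⟩ for l = [t₁, …, tₙ]. Testing the equation against words of bath operators applied to ψₖ gives
the linear hierarchy F_l' = κ F_{τ(t) :: l} in integrated form (`Bath.evolvedMoment_eq`). A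
Cameron-Martin ansatz solves it: the exponential of a double integral of the two-point function
times the moments of a Gaussian process with shifted mean (`gaussianFlow_eq`). The solution is
unique among families growing like Rⁿ √n!, because n iterations gain 1/n! from the simplex volume
and lose only Rⁿ √n! (`hierarchy_eq_zero`). The Gaussian flow has this growth by counting pairings;
the F_l have it by unitarity, Cauchy-Schwarz and Wick's formula for 2n operators. Taking l empty,
the mean is the exponential of minus the ordered double integral (`Bath.reduce_eq_exp`), which is
the exact second-order truncation.

Finally that integral is folded from [-T, T] onto [0, T] (`integral_effTime_eq_add`) and becomes I⁺
+ 2 I⁻. Conjugation exchanges the arguments of the two-point function, which makes I⁺ real and I⁻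
imaginary. -/

noncomputable section

namespace Dephasing

/-! ### Combinatorics of Wick's formula -/

/-- The sum of `f x r` over all ways to pick an element `x` of a list, leaving the list `r`. -/
def sumPick {α : Type*} : List α → (α → List α → ℂ) → ℂ
  | [], _ => 0
  | a :: l, f => f a l + sumPick l (fun x r => f x (a :: r))

/-- Trades the index sum in Wick's formula for a recursion on the list, so that the identities below
follow by structural induction without `eraseIdx` arithmetic. -/
theorem sum_eraseIdx_eq_sumPick {α : Type*} (l : List α) (f : α → List α → ℂ) :
    ∑ i : Fin l.length, f (l.get i) (l.eraseIdx i) = sumPick l f := by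
  induction l generalizing f with
  | nil => simp [sumPick]
  | cons a l ih =>
    rw [sumPick, ← ih]
    exact Fin.sum_univ_succ (n := l.length)
      (fun i => f ((a :: l).get i) ((a :: l).eraseIdx i))

/-- The length condition on the remainder allows an induction on the length to be used inside the
sum. -/
theorem sumPick_congr {α : Type*} {l : List α} {f g : α → List α → ℂ}
    (h : ∀ x r, r.length + 1 = l.length → f x r = g x r) : sumPick l f = sumPick l g := by
  induction l generalizing f g with
  | nil => rfl
  | cons a l ih =>
    rw [sumPick, sumPick, h a l (by simp)]
    congr 1
    exact ih fun x r hr => h x (a :: r) (by simpa using hr)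

theorem sumPick_add {α : Type*} (l : List α) (f g : α → List α → ℂ) :
    sumPick l (fun x r => f x r + g x r) = sumPick l f + sumPick l g := by
  induction l generalizing f g with
  | nil => simp [sumPick]
  | cons a l ih => simp only [sumPick, ih]; ring

theorem mul_sumPick {α : Type*} (l : List α) (z : ℂ) (f : α → List α → ℂ) :
    z * sumPick l f = sumPick l (fun x r => z * f x r) := by
  induction l generalizing f with
  | nil => simp [sumPick]
  | cons a l ih => simp only [sumPick, mul_add, ih]

/-- Removing x and then y leaves the same list as removing y and then x, so the order of two
successive choices is immaterial. -/
theorem sumPick_swap {α : Type*} (l : List α) (f : α → α → List α → ℂ) :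
    sumPick l (fun x r => sumPick r (fun y s => f x y s))
      = sumPick l (fun x r => sumPick r (fun y s => f y x s)) := by
  induction l generalizing f with
  | nil => rfl
  | cons a l ih =>
    simp only [sumPick, sumPick_add]
    rw [ih]
    ring

theorem norm_sumPick_le {α : Type*} {l : List α} {f : α → List α → ℂ} {M : ℝ}
    (h : ∀ x r, r.length + 1 = l.length → ‖f x r‖ ≤ M) : ‖sumPick l f‖ ≤ l.length * M := by
  induction l generalizing f with
  | nil => simp [sumPick]
  | cons a l ih =>
    have h1 := h a l (by simp)
    have h2 := ih (f := fun x r => f x (a :: r)) fun x r hr => h x (a :: r) (by simpa using hr)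
    rw [sumPick]
    refine (norm_add_le _ _).trans ?_
    push_cast [List.length_cons]
    linarith

theorem hasDerivAt_sumPick {α : Type*} {l : List α} {f : ℝ → α → List α → ℂ}
    {f' : α → List α → ℂ} {t : ℝ}
    (h : ∀ x r, r.length + 1 = l.length → HasDerivAt (fun s => f s x r) (f' x r) t) :
    HasDerivAt (fun s => sumPick l (f s)) (sumPick l f') t := by
  induction l generalizing f f' with
  | nil => exact hasDerivAt_const _ _
  | cons a l ih =>
    exact (h a l (by simp)).add (ih fun x r hr => h x (a :: r) (by simpa using hr))

theorem continuousAt_sumPick {X α : Type*} [TopologicalSpace X] {l : List α}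
    {f : X → α → List α → ℂ} {t : X}
    (h : ∀ x r, r.length + 1 = l.length → ContinuousAt (fun s => f s x r) t) :
    ContinuousAt (fun s => sumPick l (f s)) t := by
  induction l generalizing f with
  | nil => exact continuousAt_const
  | cons a l ih =>
    exact (h a l (by simp)).add (ih fun x r hr => h x (a :: r) (by simpa using hr))

/-- Moments of a Gaussian process with mean `h` and two-point function `c`: the sum over all
partial pairings of products of two-point functions and means of the unpaired arguments. -/
def wickShift (c : ℝ → ℝ → ℂ) (h : ℝ → ℂ) : List ℝ → ℂ
  | [] => 1
  | a :: l => h a * wickShift c h l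
      + ∑ i : Fin l.length, c a (l.get i) * wickShift c h (l.eraseIdx i)
termination_by l => l.length
decreasing_by
  · simp
  · have hi := i.2
    simp [List.length_eraseIdx, hi]

theorem wickShift_nil (c : ℝ → ℝ → ℂ) (h : ℝ → ℂ) : wickShift c h [] = 1 := by
  rw [wickShift]

theorem wickShift_cons (c : ℝ → ℝ → ℂ) (h : ℝ → ℂ) (a : ℝ) (l : List ℝ) :
    wickShift c h (a :: l)
      = h a * wickShift c h l + sumPick l (fun x r => c a x * wickShift c h r) := by
  rw [wickShift, ← sum_eraseIdx_eq_sumPick]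

theorem wickShift_zero (c : ℝ → ℝ → ℂ) (l : List ℝ) : wickShift c 0 l = wick c l := by
  induction hn : l.length using Nat.strong_induction_on generalizing l with
  | _ n ih =>
    cases l with
    | nil => rw [wickShift, wick]
    | cons a l =>
      rw [wickShift, wick]
      simp only [Pi.zero_apply, zero_mul, zero_add]
      refine Finset.sum_congr rfl fun i _ => ?_
      have hi := i.2
      rw [ih (l.eraseIdx i).length _ _ rfl]
      rw [← hn]
      simp [List.length_eraseIdx, hi]

/-- The variation `∑ₓ k x · wickShift (l \ x)` satisfies the Leibniz rule. -/
theorem sumPick_wickShift_cons (c : ℝ → ℝ → ℂ) (h k : ℝ → ℂ) (a : ℝ) (l : List ℝ) :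
    sumPick (a :: l) (fun x r => k x * wickShift c h r)
      = k a * wickShift c h l + h a * sumPick l (fun x r => k x * wickShift c h r)
        + sumPick l (fun y r => c a y * sumPick r (fun x s => k x * wickShift c h s)) := by
  simp only [sumPick, wickShift_cons, mul_add, sumPick_add, mul_sumPick]
  -- When `a` is paired with y and x is varied, the left side removes x first and the right side y
  -- first.
  rw [sumPick_swap, add_assoc]
  congr 2
  · exact sumPick_congr fun x r _ => by ring
  · exact sumPick_congr fun x r _ => sumPick_congr fun y s _ => by ring

theorem sumPick_append_singleton {α : Type*} (l : List α) (a : α) (f : α → List α → ℂ) :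
    sumPick (l ++ [a]) f = f a l + sumPick l (fun x r => f x (r ++ [a])) := by
  induction l generalizing f with
  | nil => simp [sumPick]
  | cons b l ih =>
    simp only [List.cons_append, sumPick, ih]
    ring

/-- The same partial pairings, sorted by the fate of the last argument instead of the first. This is
the form required by the dynamics: the Schrödinger equation inserts each new bath operator at the
right end of the word, next to the evolution operator. -/
theorem wickShift_append_singleton (c : ℝ → ℝ → ℂ) (h : ℝ → ℂ) (l : List ℝ) (t : ℝ) :
    wickShift c h (l ++ [t])
      = h t * wickShift c h l + sumPick l (fun x r => c x t * wickShift c h r) := by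
  induction hn : l.length using Nat.strong_induction_on generalizing l with
  | _ n ih =>
    cases l with
    | nil => simp [wickShift_cons, wickShift_nil, sumPick]
    | cons a l =>
      have hl : l.length < n := by rw [← hn]; simp
      rw [sumPick_wickShift_cons c h (fun x => c x t), List.cons_append, wickShift_cons,
        sumPick_append_singleton, ih _ hl l rfl, wickShift_cons]
      have : sumPick l (fun x r => c a x * wickShift c h (r ++ [t]))
          = h t * sumPick l (fun x r => c a x * wickShift c h r)
            + sumPick l (fun y r => c a y * sumPick r (fun x s => c x t * wickShift c h s)) := by
        rw [mul_sumPick, ← sumPick_add]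
        refine sumPick_congr fun x r hr => ?_
        rw [ih r.length (by omega) r rfl]
        ring
      rw [this]
      ring

/-- Each term is a product containing the means at the unpaired positions. Differentiation marks one
such position x, and the remaining factors add up to `wickShift` of the list without x. The
induction closes because this variation obeys the Leibniz rule `sumPick_wickShift_cons`. -/
theorem hasDerivAt_wickShift (c : ℝ → ℝ → ℂ) {h : ℝ → ℝ → ℂ} {h' : ℝ → ℂ} {t : ℝ}
    (hh : ∀ x, HasDerivAt (fun s => h s x) (h' x) t) (l : List ℝ) :
    HasDerivAt (fun s => wickShift c (h s) l)
      (sumPick l (fun x r => h' x * wickShift c (h t) r)) t := by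
  induction hn : l.length using Nat.strong_induction_on generalizing l with
  | _ n ih =>
    cases l with
    | nil => simpa [wickShift_nil, sumPick] using hasDerivAt_const t (1 : ℂ)
    | cons a l =>
      have hl : l.length < n := by rw [← hn]; simp
      rw [sumPick_wickShift_cons]
      simp only [wickShift_cons]
      exact ((hh a).mul (ih _ hl l rfl)).add (hasDerivAt_sumPick fun x r hr =>
        (ih r.length (by omega) r rfl).const_mul (c a x))

theorem continuousAt_wickShift {X : Type*} [TopologicalSpace X] (c : ℝ → ℝ → ℂ)
    {h : X → ℝ → ℂ} {t : X} (hh : ∀ x, ContinuousAt (fun s => h s x) t) (l : List ℝ) :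
    ContinuousAt (fun s => wickShift c (h s) l) t := by
  induction hn : l.length using Nat.strong_induction_on generalizing l with
  | _ n ih =>
    cases l with
    | nil => simpa [wickShift_nil] using continuousAt_const
    | cons a l =>
      have hl : l.length < n := by rw [← hn]; simp
      simp only [wickShift_cons]
      exact ((hh a).mul (ih _ hl l rfl)).add (continuousAt_sumPick fun x r hr =>
        continuousAt_const.mul (ih r.length (by omega) r rfl))

/-- The recursion bounds the moment of order n + 1 by K times that of order n plus C n times that of
order n - 1, and n √(n-1)! ≤ √(n+1)!. Having only the square root of a factorial is what leaves
decay when the hierarchy is iterated. -/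
theorem norm_wickShift_le {c : ℝ → ℝ → ℂ} {h : ℝ → ℂ} {C K R : ℝ} (hc : ∀ x y, ‖c x y‖ ≤ C)
    (hh : ∀ x, ‖h x‖ ≤ K) (hR : 1 ≤ R) (hKC : K + C ≤ R) (l : List ℝ) :
    ‖wickShift c h l‖ ≤ R ^ l.length * √(l.length.factorial) := by
  have hC : 0 ≤ C := (norm_nonneg _).trans (hc 0 0)
  have hK : 0 ≤ K := (norm_nonneg _).trans (hh 0)
  induction hn : l.length using Nat.strong_induction_on generalizing l with
  | _ n ih =>
    cases l with
    | nil => subst hn; simp [wickShift_nil]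
    | cons a l =>
      have hl : l.length + 1 = n := by rw [← hn]; simp
      subst hl
      have h1 := ih _ (Nat.lt_succ_self _) l rfl
      have hmono : √(l.length.factorial : ℝ) ≤ √((l.length + 1).factorial : ℝ) :=
        Real.sqrt_le_sqrt (by exact_mod_cast Nat.factorial_le (Nat.le_succ _))
      have hp : 0 ≤ R ^ l.length := by positivity
      have h2 : ‖sumPick l (fun x r => c a x * wickShift c h r)‖
          ≤ C * (R ^ l.length * √((l.length + 1).factorial : ℝ)) := by
        rcases hm : l.length with _ | m
        · rw [List.length_eq_zero_iff] at hm
          subst hm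
          simpa [sumPick] using hC
        · have h3 := norm_sumPick_le (l := l) (f := fun x r => c a x * wickShift c h r)
            (M := C * (R ^ m * √(m.factorial : ℝ))) fun x r hr => by
              have hrm : r.length = m := by omega
              rw [norm_mul]
              have := ih r.length (by omega) r rfl
              rw [hrm] at this
              exact mul_le_mul (hc _ _) this (norm_nonneg _) hC
          refine h3.trans ?_
          rw [hm, mul_left_comm]
          refine mul_le_mul_of_nonneg_left ?_ hC
          have h4 : ((m + 1 : ℕ) : ℝ) * √(m.factorial : ℝ) ≤ √((m + 1 + 1).factorial : ℝ) := by
            refine Real.le_sqrt_of_sq_le ?_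
            rw [mul_pow, Real.sq_sqrt (by positivity), Nat.factorial_succ (m + 1),
              Nat.factorial_succ m]
            push_cast
            have : (0 : ℝ) ≤ m.factorial := by positivity
            nlinarith [mul_nonneg (by positivity : (0 : ℝ) ≤ (m : ℝ) + 1) this]
          calc ((m + 1 : ℕ) : ℝ) * (R ^ m * √(m.factorial : ℝ))
              = R ^ m * (((m + 1 : ℕ) : ℝ) * √(m.factorial : ℝ)) := by ring
            _ ≤ R ^ (m + 1) * √((m + 1 + 1).factorial : ℝ) :=
              mul_le_mul (pow_le_pow_right₀ hR (Nat.le_succ m)) h4 (by positivity) (by positivity)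
      rw [wickShift_cons]
      calc _ ≤ ‖h a * wickShift c h l‖ + _ := norm_add_le _ _
        _ ≤ K * (R ^ l.length * √((l.length + 1).factorial : ℝ))
            + C * (R ^ l.length * √((l.length + 1).factorial : ℝ)) := by
          refine add_le_add ?_ h2
          rw [norm_mul]
          exact mul_le_mul (hh a) (h1.trans (mul_le_mul_of_nonneg_left hmono hp))
            (norm_nonneg _) hK
        _ = (K + C) * (R ^ l.length * √((l.length + 1).factorial : ℝ)) := by ring
        _ ≤ R * (R ^ l.length * √((l.length + 1).factorial : ℝ)) :=
          mul_le_mul_of_nonneg_right hKC (by positivity)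
        _ = _ := by rw [pow_succ]; ring

/-! ### Weak solutions of the Schrödinger equation -/

section WeakSolutions

variable {E : Type*} [NormedAddCommGroup E] [InnerProductSpace ℂ E]

theorem jointOp_mul_apply (L V : JointOp E) (i j : Fin 2) (χ : E) :
    (L * V) i j χ = ∑ m, L i m (V m j χ) := by
  simp [Matrix.mul_apply]

theorem onQubit_apply (S : Matrix (Fin 2) (Fin 2) ℂ) (i j : Fin 2) (χ : E) :
    onQubit E S i j χ = S i j • χ := by
  simp [onQubit]

/-- The family `L t` solves the Schrödinger equation of the Hamiltonian `A(t) ⊗ X(t)` on `[a, c]`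
in integrated form, tested against vectors of `D`. -/
structure IsWeakSolution (D : Submodule ℂ E) (X : ℝ → D →ₗ[ℂ] D)
    (A : ℝ → Matrix (Fin 2) (Fin 2) ℂ) (a c : ℝ) (L : ℝ → JointOp E) : Prop where
  integrable : ∀ s ∈ Set.Icc a c, ∀ t ∈ Set.Icc a c, ∀ (i j : Fin 2) (φ : D) (χ : E),
    IntervalIntegrable (fun u => ∑ k, A u i k * ⟪(X u φ : E), L u k j χ⟫_ℂ) volume s t
  eq : ∀ s ∈ Set.Icc a c, ∀ t ∈ Set.Icc a c, ∀ (i j : Fin 2) (φ : D) (χ : E),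
    ⟪(φ : E), L t i j χ⟫_ℂ = ⟪(φ : E), L s i j χ⟫_ℂ
        - I * ∫ u in s..t, ∑ k, A u i k * ⟪(X u φ : E), L u k j χ⟫_ℂ

variable {D : Submodule ℂ E} {X X' : ℝ → D →ₗ[ℂ] D} {A A' : ℝ → Matrix (Fin 2) (Fin 2) ℂ}
  {a m c : ℝ} {L L' : ℝ → JointOp E}

theorem one_jointOp_apply (i j : Fin 2) (φ χ : E) :
    ⟪φ, (1 : JointOp E) i j χ⟫_ℂ = if i = j then ⟪φ, χ⟫_ℂ else 0 := by
  rw [Matrix.one_apply]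
  split_ifs <;> simp

theorem IsPropagator.isWeakSolution [CompleteSpace E] {U : ℝ → ℝ → JointOp E}
    (hU : IsPropagator D X A a c U) {s₀ : ℝ} (h₀ : s₀ ∈ Set.Icc a c) :
    IsWeakSolution D X A a c (fun t => U t s₀) where
  integrable s hs t ht i j φ χ :=
    (hU.integrable s₀ h₀ s hs i j φ χ).symm.trans (hU.integrable s₀ h₀ t ht i j φ χ)
  eq s hs t ht i j φ χ := by
    rw [hU.schrodinger s₀ h₀ t ht, hU.schrodinger s₀ h₀ s hs,
      ← intervalIntegral.integral_interval_sub_left (hU.integrable s₀ h₀ t ht i j φ χ)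
        (hU.integrable s₀ h₀ s hs i j φ χ)]
    ring

namespace IsWeakSolution

/-- The equation holds for every χ, so χ can be replaced by V n j χ and summed over n. Right
multiplication thus changes only the initial value. -/
theorem mul_right (h : IsWeakSolution D X A a c L) (V : JointOp E) :
    IsWeakSolution D X A a c (fun t => L t * V) := by
  have key : ∀ (i j : Fin 2) (φ : D) (χ : E) (u : ℝ),
      ∑ k, A u i k * ⟪(X u φ : E), (L u * V) k j χ⟫_ℂ
        = ∑ n, ∑ k, A u i k * ⟪(X u φ : E), L u k n (V n j χ)⟫_ℂ := by
    intro i j φ χ u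
    rw [Finset.sum_comm]
    simp only [jointOp_mul_apply, inner_sum, Finset.mul_sum]
  have hint : ∀ s ∈ Set.Icc a c, ∀ t ∈ Set.Icc a c, ∀ (i j : Fin 2) (φ : D) (χ : E),
      ∀ n ∈ Finset.univ, IntervalIntegrable
        (fun u => ∑ k, A u i k * ⟪(X u φ : E), L u k n (V n j χ)⟫_ℂ) volume s t :=
    fun s hs t ht i j φ χ n _ => h.integrable s hs t ht i n φ _
  constructor
  · intro s hs t ht i j φ χ
    simp only [key]
    have := IntervalIntegrable.sum Finset.univ (hint s hs t ht i j φ χ)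
    rwa [show (∑ n, fun u => _) = fun u => ∑ n, _ from funext fun u => Finset.sum_apply u _ _]
      at this
  · intro s hs t ht i j φ χ
    simp only [key]
    rw [intervalIntegral.integral_finsetSum (hint s hs t ht i j φ χ), Finset.mul_sum,
      jointOp_mul_apply, jointOp_mul_apply, inner_sum, inner_sum, ← Finset.sum_sub_distrib]
    exact Finset.sum_congr rfl fun n _ => h.eq s hs t ht i n φ _

/-- A qubit operator commutes with the bath operators, so only the qubit factors must intertwine.
The form A' S = S A avoids an inverse of S. -/
theorem conj (h : IsWeakSolution D X A a c L) (S : Matrix (Fin 2) (Fin 2) ℂ)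
    (hS : ∀ u, A' u * S = S * A u) :
    IsWeakSolution D X A' a c (fun t => onQubit E S * L t) := by
  have key : ∀ (i j : Fin 2) (φ : D) (χ : E) (u : ℝ),
      ∑ k, A' u i k * ⟪(X u φ : E), (onQubit E S * L u) k j χ⟫_ℂ
        = ∑ n, S i n * ∑ k, A u n k * ⟪(X u φ : E), L u k j χ⟫_ℂ := by
    intro i j φ χ u
    have hS' : ∀ k, A' u i 0 * S 0 k + A' u i 1 * S 1 k = S i 0 * A u 0 k + S i 1 * A u 1 k := by
      intro k
      have := congrFun (congrFun (hS u) i) k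
      simpa [Matrix.mul_apply, Fin.sum_univ_two] using this
    simp only [jointOp_mul_apply, onQubit_apply, inner_add_right, inner_smul_right,
      Fin.sum_univ_two]
    linear_combination ⟪(X u φ : E), L u 0 j χ⟫_ℂ * hS' 0 + ⟪(X u φ : E), L u 1 j χ⟫_ℂ * hS' 1
  have hint : ∀ s ∈ Set.Icc a c, ∀ t ∈ Set.Icc a c, ∀ (i j : Fin 2) (φ : D) (χ : E),
      ∀ n ∈ Finset.univ, IntervalIntegrable
        (fun u => S i n * ∑ k, A u n k * ⟪(X u φ : E), L u k j χ⟫_ℂ) volume s t :=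
    fun s hs t ht i j φ χ n _ => (h.integrable s hs t ht n j φ _).const_mul _
  constructor
  · intro s hs t ht i j φ χ
    simp only [key]
    have := IntervalIntegrable.sum Finset.univ (hint s hs t ht i j φ χ)
    rwa [show (∑ n, fun u => _) = fun u => ∑ n, _ from funext fun u => Finset.sum_apply u _ _]
      at this
  · intro s hs t ht i j φ χ
    simp only [key]
    rw [intervalIntegral.integral_finsetSum (hint s hs t ht i j φ χ), Finset.mul_sum,
      jointOp_mul_apply, jointOp_mul_apply, inner_sum, inner_sum, ← Finset.sum_sub_distrib]
    refine Finset.sum_congr rfl fun n _ => ?_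
    rw [onQubit_apply, onQubit_apply, inner_smul_right, inner_smul_right,
      h.eq s hs t ht n j φ χ, intervalIntegral.integral_const_mul]
    ring

theorem mono (h : IsWeakSolution D X A a c L) {a' c' : ℝ}
    (hac : Set.Icc a' c' ⊆ Set.Icc a c) : IsWeakSolution D X A a' c' L where
  integrable s hs t ht := h.integrable s (hac hs) t (hac ht)
  eq s hs t ht := h.eq s (hac hs) t (hac ht)

/-- Values of the Hamiltonian and of the solution matter only in the interior. -/
theorem congr (h : IsWeakSolution D X A a c L) (hX : ∀ u ∈ Set.Ioo a c, X u = X' u)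
    (hA : ∀ u ∈ Set.Ioo a c, A u = A' u) (hL : ∀ u ∈ Set.Icc a c, L u = L' u) :
    IsWeakSolution D X' A' a c L' := by
  have key : ∀ s ∈ Set.Icc a c, ∀ t ∈ Set.Icc a c, ∀ (i j : Fin 2) (φ : D) (χ : E),
      ∀ᵐ u, u ∈ Set.uIoc s t → ∑ k, A u i k * ⟪(X u φ : E), L u k j χ⟫_ℂ
        = ∑ k, A' u i k * ⟪(X' u φ : E), L' u k j χ⟫_ℂ := by
    intro s hs t ht i j φ χ
    have hne : ∀ᵐ u : ℝ, u ≠ c := by simp [ae_iff]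
    filter_upwards [hne] with u hu hmem
    have hu1 : u ∈ Set.Ioo a c := by
      rcases Set.mem_uIoc.1 hmem with h' | h'
      · exact ⟨hs.1.trans_lt h'.1, lt_of_le_of_ne (h'.2.trans ht.2) hu⟩
      · exact ⟨ht.1.trans_lt h'.1, lt_of_le_of_ne (h'.2.trans hs.2) hu⟩
    rw [hX u hu1, hA u hu1]
    simp only [hL u (Set.Ioo_subset_Icc_self hu1)]
  constructor
  · intro s hs t ht i j φ χ
    refine (h.integrable s hs t ht i j φ χ).congr_ae ?_
    exact (ae_restrict_iff' measurableSet_uIoc).2 (key s hs t ht i j φ χ)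
  · intro s hs t ht i j φ χ
    rw [← hL t ht, ← hL s hs, h.eq s hs t ht i j φ χ,
      intervalIntegral.integral_congr_ae (key s hs t ht i j φ χ)]

theorem glue (h : IsWeakSolution D X A a m L) (h' : IsWeakSolution D X A m c L')
    (ham : a ≤ m) (hmc : m ≤ c) (hm : L m = L' m) :
    IsWeakSolution D X A a c (fun t => if t ≤ m then L t else L' t) := by
  set K : ℝ → JointOp E := fun t => if t ≤ m then L t else L' t with hK
  have h1 : IsWeakSolution D X A a m K :=
    h.congr (fun _ _ => rfl) (fun _ _ => rfl) fun u hu => by simp [hK, hu.2]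
  have h2 : IsWeakSolution D X A m c K :=
    h'.congr (fun _ _ => rfl) (fun _ _ => rfl) fun u hu => by
      rcases eq_or_lt_of_le hu.1 with rfl | hlt
      · simp [hK, hm]
      · simp [hK, hlt.not_ge]
  -- It suffices to use the gluing point m as base point: integrals between arbitrary times are
  -- differences of integrals from m.
  have hbase : ∀ t ∈ Set.Icc a c, ∀ (i j : Fin 2) (φ : D) (χ : E),
      IntervalIntegrable (fun u => ∑ k, A u i k * ⟪(X u φ : E), K u k j χ⟫_ℂ) volume m t
      ∧ ⟪(φ : E), K t i j χ⟫_ℂ = ⟪(φ : E), K m i j χ⟫_ℂ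
        - I * ∫ u in m..t, ∑ k, A u i k * ⟪(X u φ : E), K u k j χ⟫_ℂ := by
    intro t ht i j φ χ
    rcases le_total t m with htm | htm
    · exact ⟨h1.integrable m ⟨ham, le_rfl⟩ t ⟨ht.1, htm⟩ i j φ χ,
        h1.eq m ⟨ham, le_rfl⟩ t ⟨ht.1, htm⟩ i j φ χ⟩
    · exact ⟨h2.integrable m ⟨le_rfl, hmc⟩ t ⟨htm, ht.2⟩ i j φ χ,
        h2.eq m ⟨le_rfl, hmc⟩ t ⟨htm, ht.2⟩ i j φ χ⟩
  constructor
  · intro s hs t ht i j φ χ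
    exact (hbase s hs i j φ χ).1.symm.trans (hbase t ht i j φ χ).1
  · intro s hs t ht i j φ χ
    rw [(hbase s hs i j φ χ).2, (hbase t ht i j φ χ).2,
      ← intervalIntegral.integral_interval_sub_left (hbase t ht i j φ χ).1
        (hbase s hs i j φ χ).1]
    ring

theorem shift (h : IsWeakSolution D X A a c L) (d : ℝ) :
    IsWeakSolution D (fun t => X (d + t)) (fun t => A (d + t)) (a - d) (c - d)
      (fun t => L (d + t)) := by
  have hmem : ∀ s ∈ Set.Icc (a - d) (c - d), d + s ∈ Set.Icc a c := fun s hs =>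
    ⟨by linarith [hs.1], by linarith [hs.2]⟩
  constructor
  · intro s hs t ht i j φ χ
    have := (h.integrable _ (hmem s hs) _ (hmem t ht) i j φ χ).comp_add_left d
    simpa using this
  · intro s hs t ht i j φ χ
    rw [h.eq _ (hmem s hs) _ (hmem t ht) i j φ χ,
      intervalIntegral.integral_comp_add_left
        (fun u => ∑ k, A u i k * ⟪(X u φ : E), L u k j χ⟫_ℂ) d]

/-- Time reversal changes the sign of the time derivative, hence of the coupling. -/
theorem reflect (h : IsWeakSolution D X A a c L) (d : ℝ) :
    IsWeakSolution D (fun t => X (d - t)) (fun t => -A (d - t)) (d - c) (d - a)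
      (fun t => L (d - t)) := by
  have hmem : ∀ s ∈ Set.Icc (d - c) (d - a), d - s ∈ Set.Icc a c := fun s hs =>
    ⟨by linarith [hs.2], by linarith [hs.1]⟩
  have key : ∀ (i j : Fin 2) (φ : D) (χ : E) (u : ℝ),
      ∑ k, (-A (d - u)) i k * ⟪(X (d - u) φ : E), L (d - u) k j χ⟫_ℂ
        = -∑ k, A (d - u) i k * ⟪(X (d - u) φ : E), L (d - u) k j χ⟫_ℂ := by
    intro i j φ χ u
    simp [Finset.sum_neg_distrib]
  constructor
  · intro s hs t ht i j φ χ
    simp only [key]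
    have := (h.integrable _ (hmem s hs) _ (hmem t ht) i j φ χ).comp_sub_left d
    rw [sub_sub_cancel, sub_sub_cancel] at this
    exact this.neg
  · intro s hs t ht i j φ χ
    simp only [key]
    rw [h.eq _ (hmem s hs) _ (hmem t ht) i j φ χ, intervalIntegral.integral_neg,
      intervalIntegral.integral_comp_sub_left
        (fun u => ∑ k, A u i k * ⟪(X u φ : E), L u k j χ⟫_ℂ) d,
      intervalIntegral.integral_symm (d - s), neg_neg]

/-- A one-parameter unitary solution already determines a two-time propagator, L(t) L(s)†: for fixed
s this is a right multiple of L. -/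
theorem isPropagator [CompleteSpace E] (h : IsWeakSolution D X A a c L)
    (hL : ∀ t ∈ Set.Icc a c, L t ∈ unitary (JointOp E)) :
    IsPropagator D X A a c (fun t s => L t * star (L s)) where
  mem_unitary s hs t ht := mul_mem (hL t ht) (Unitary.star_mem (hL s hs))
  self t ht := (Unitary.mem_iff.1 (hL t ht)).2
  comp s hs u hu t ht := by
    rw [mul_assoc, ← mul_assoc (star (L u)), (Unitary.mem_iff.1 (hL u hu)).1, one_mul]
  integrable s hs t ht := (h.mul_right (star (L s))).integrable s hs t ht
  schrodinger s hs t ht i j φ χ := by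
    rw [(h.mul_right (star (L s))).eq s hs t ht i j φ χ, (Unitary.mem_iff.1 (hL s hs)).2,
      one_jointOp_apply]

/-- Concatenation of evolutions over consecutive intervals. -/
theorem chain [CompleteSpace E] {n : ℕ} (tp : Fin (n + 1) → ℝ) (htp : Monotone tp)
    (V : Fin n → JointOp E)
    (hV : ∀ k : Fin n, ∃ L, IsWeakSolution D X A (tp k.castSucc) (tp k.succ) L
      ∧ (∀ t ∈ Set.Icc (tp k.castSucc) (tp k.succ), L t ∈ unitary (JointOp E))
      ∧ L (tp k.castSucc) = 1 ∧ L (tp k.succ) = V k) :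
    ∃ L, IsWeakSolution D X A (tp 0) (tp (Fin.last n)) L
      ∧ (∀ t ∈ Set.Icc (tp 0) (tp (Fin.last n)), L t ∈ unitary (JointOp E))
      ∧ L (tp 0) = 1 ∧ L (tp (Fin.last n)) = (List.ofFn V).reverse.prod := by
  induction n with
  | zero =>
    refine ⟨fun _ => 1, ?_, fun _ _ => one_mem _, rfl, by simp⟩
    have hst : ∀ s ∈ Set.Icc (tp 0) (tp (Fin.last 0)), s = tp 0 := fun s hs =>
      le_antisymm hs.2 hs.1
    constructor
    · intro s hs t ht i j φ χ
      rw [hst s hs, hst t ht]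
    · intro s hs t ht i j φ χ
      rw [hst s hs, hst t ht]
      simp
  | succ n ih =>
    obtain ⟨L₀, h₀, hu₀, hs₀, ht₀⟩ := hV 0
    obtain ⟨L₁, h₁, hu₁, hs₁, ht₁⟩ := ih (fun k => tp k.succ)
      (fun i j hij => htp (Fin.succ_le_succ_iff.2 hij)) (fun k => V k.succ) fun k => hV k.succ
    simp only [Fin.castSucc_zero, Fin.succ_last] at h₀ hu₀ hs₀ ht₀ h₁ hu₁ hs₁ ht₁
    have h01 : tp 0 ≤ tp (Fin.succ 0) := htp (Fin.zero_le _)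
    have h1l : tp (Fin.succ 0) ≤ tp (Fin.last (n + 1)) := htp (Fin.le_last _)
    have hV0 : V 0 ∈ unitary (JointOp E) := ht₀ ▸ hu₀ _ ⟨h01, le_rfl⟩
    refine ⟨_, h₀.glue (h₁.mul_right (V 0)) h01 h1l (by rw [ht₀, hs₁, one_mul]), ?_, ?_, ?_⟩
    · intro t ht
      split_ifs with hle
      · exact hu₀ t ⟨ht.1, hle⟩
      · exact mul_mem (hu₁ t ⟨(not_le.1 hle).le, ht.2⟩) hV0
    · simp only [h01, if_true, hs₀]
    · rw [List.ofFn_succ, List.reverse_cons, List.prod_append, List.prod_singleton, ← ht₁]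
      -- Since `tp` is only monotone here, the remaining intervals may shrink to a point, where the
      -- glued function still takes its first value.
      split_ifs with hle
      · have : tp (Fin.last (n + 1)) = tp (Fin.succ 0) := le_antisymm hle h1l
        rw [this, ht₀, hs₁, one_mul]
      · rfl

end IsWeakSolution

end WeakSolutions

/-! ### Pauli matrices and rotations -/

theorem pauli_mul_self (o : Axis) : pauli o * pauli o = 1 := by
  cases o <;> simp [pauli, Matrix.one_fin_two]

theorem pauli_inv (o : Axis) : (pauli o)⁻¹ = pauli o :=
  Matrix.inv_eq_left_inv (pauli_mul_self o)

theorem pauli_conjTranspose (o : Axis) : (pauli o)ᴴ = pauli o := by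
  cases o <;> ext i j <;> fin_cases i <;> fin_cases j <;> simp [pauli]

theorem pauli_pow_conjTranspose (o : Axis) (n : ℕ) : (pauli o ^ n)ᴴ = pauli o ^ n := by
  rw [Matrix.conjTranspose_pow, pauli_conjTranspose]

theorem pauliSign_mul_self (o α : Axis) : pauliSign o α * pauliSign o α = 1 := by
  cases o <;> cases α <;> simp [pauliSign, pauli, Matrix.trace_fin_two]

theorem pauliSign_eq (o α : Axis) : pauliSign o α = 1 ∨ pauliSign o α = -1 :=
  mul_self_eq_one_iff.1 (pauliSign_mul_self o α)

/-- Pauli matrices commute up to the sign `f_o^α`. -/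
theorem pauli_mul_pauli (o α : Axis) :
    pauli o * pauli α = (pauliSign o α : ℂ) • (pauli α * pauli o) := by
  cases o <;> cases α <;> ext i j <;> fin_cases i <;> fin_cases j <;>
    simp [pauliSign, pauli, Matrix.trace_fin_two]

theorem pauli_mul_pauli_pow (o α : Axis) (n : ℕ) :
    pauli o * pauli α ^ n = (pauliSign o α : ℂ) ^ n • (pauli α ^ n * pauli o) := by
  induction n with
  | zero => simp
  | succ n ih =>
    rw [pow_succ, ← mul_assoc, ih, smul_mul_assoc, mul_assoc, pauli_mul_pauli, mul_smul_comm,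
      smul_smul, pow_succ, mul_assoc]

theorem pauli_conj (o α : Axis) :
    (pauli o)⁻¹ * pauli α * pauli o = (pauliSign o α : ℂ) • pauli α := by
  rw [pauli_inv, pauli_mul_pauli, smul_mul_assoc, mul_assoc, pauli_mul_self, mul_one]

theorem exp_smul_pauli_y (z : ℂ) :
    NormedSpace.exp (z • pauli Axis.y) = cosh z • 1 + sinh z • pauli Axis.y := by
  -- The columns (1, i) and (1, -i) are eigenvectors of σ_y for 1 and -1, so the exponential reduces
  -- to a diagonal one.
  let V : (Matrix (Fin 2) (Fin 2) ℂ)ˣ :=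
    ⟨!![1, 1; I, -I], !![1 / 2, -I / 2; 1 / 2, I / 2], by
      ext i j; fin_cases i <;> fin_cases j <;> simp [← mul_div_assoc] <;> ring_nf, by
      ext i j; fin_cases i <;> fin_cases j <;> simp [Matrix.mul_apply, Fin.sum_univ_two] <;> ring_nf
        <;> simp <;> norm_num⟩
  have hd : ∀ p q : ℂ, Matrix.diagonal ![p, q] = !![p, 0; 0, q] := fun p q => by
    ext i j; fin_cases i <;> fin_cases j <;> simp
  have hV : z • pauli Axis.y
      = (V : Matrix (Fin 2) (Fin 2) ℂ) * Matrix.diagonal ![z, -z] * (V⁻¹ : _ˣ) := by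
    rw [hd]
    ext i j
    fin_cases i <;> fin_cases j <;>
      simp [V, pauli, Matrix.mul_apply, Fin.sum_univ_two] <;> ring_nf
  rw [hV, Matrix.exp_units_conj, Matrix.exp_diagonal]
  have he : (NormedSpace.exp ![z, -z] : Fin 2 → ℂ) = ![exp z, exp (-z)] := by
    rw [Pi.exp_def]
    ext i
    fin_cases i <;> simp [Complex.exp_eq_exp_ℂ]
  rw [he, hd]
  ext i j
  fin_cases i <;> fin_cases j <;>
    simp [V, pauli, Matrix.mul_apply, Fin.sum_univ_two, cosh, sinh] <;> ring_nf
  simp only [I_sq]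
  ring

theorem yRotation_eq (θ : ℝ) :
    yRotation θ = (rotCoeff θ 0 : ℂ) • (1 : Matrix (Fin 2) (Fin 2) ℂ)
      + ((rotCoeff θ 1 : ℂ) * I) • pauli Axis.y := by
  rw [yRotation, exp_smul_pauli_y]
  have h0 : cosh (-I * ((θ / 2 : ℝ) : ℂ)) = (rotCoeff θ 0 : ℂ) := by
    rw [neg_mul, cosh_neg, mul_comm, cosh_mul_I, rotCoeff, ← ofReal_cos]
    simp
  have h1 : sinh (-I * ((θ / 2 : ℝ) : ℂ)) = (rotCoeff θ 1 : ℂ) * I := by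
    rw [neg_mul, sinh_neg, mul_comm, sinh_mul_I, rotCoeff]
    simp [Real.cos_add_pi_div_two]
  rw [h0, h1]

theorem yRotation_pi : yRotation Real.pi = (-I) • pauli Axis.y := by
  rw [yRotation_eq]
  simp [rotCoeff]

theorem yRotation_commute (α : ℝ) : Commute (yRotation α) (pauli Axis.y) := by
  rw [yRotation_eq]
  exact ((Commute.one_left _).smul_left _).add_left ((Commute.refl _).smul_left _)

theorem piControl_eq (P : Finset ℝ) (t : ℝ) :
    piControl P t = (-I) ^ (P.filter (fun τ => τ ≤ t)).card
      • pauli Axis.y ^ (P.filter (fun τ => τ ≤ t)).card := by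
  rw [piControl, yRotation_pi, smul_pow]

/-- Covers both toggling-frame identities: s = -1 for σ_z, which anticommutes with σ_y, and s = 1
for rotations about y. The phases (-i)ⁿ cancel against their conjugates. -/
theorem piControl_conj (P : Finset ℝ) (t : ℝ) {M : Matrix (Fin 2) (Fin 2) ℂ} {s : ℂ}
    (hM : M * pauli Axis.y = s • (pauli Axis.y * M)) :
    (piControl P t)ᴴ * M * piControl P t = s ^ (P.filter (fun τ => τ ≤ t)).card • M := by
  rw [piControl_eq]
  generalize (P.filter (fun τ => τ ≤ t)).card = n
  have h1 : M * pauli Axis.y ^ n = s ^ n • (pauli Axis.y ^ n * M) := by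
    induction n with
    | zero => simp
    | succ n ih =>
      rw [pow_succ, ← mul_assoc, ih, smul_mul_assoc, mul_assoc, hM, mul_smul_comm,
        smul_smul, pow_succ, mul_assoc]
  have h2 : pauli Axis.y ^ n * pauli Axis.y ^ n = 1 := by
    rw [← (Commute.refl _).mul_pow, pauli_mul_self, one_pow]
  have h3 : star ((-I) ^ n) * (-I) ^ n = 1 := by
    rw [star_pow, ← mul_pow]
    simp
  rw [Matrix.conjTranspose_smul, pauli_pow_conjTranspose, smul_mul_assoc, smul_mul_assoc,
    mul_smul_comm, smul_smul, h3, one_smul, mul_assoc, h1, mul_smul_comm, ← mul_assoc, h2, one_mul]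

theorem piControl_conj_pauli_z (P : Finset ℝ) (t : ℝ) :
    (piControl P t)ᴴ * pauli Axis.z * piControl P t = (switching P t : ℂ) • pauli Axis.z := by
  have h : pauliSign Axis.z Axis.y = -1 := by
    simp [pauliSign, pauli, Matrix.trace_fin_two]
  rw [piControl_conj P t (pauli_mul_pauli Axis.z Axis.y), h, switching]
  push_cast
  rfl

theorem piControl_conj_yRotation (P : Finset ℝ) (t α : ℝ) :
    (piControl P t)ᴴ * yRotation α * piControl P t = yRotation α := by
  rw [piControl_conj P t (s := 1) (by rw [one_smul]; exact yRotation_commute α), one_pow, one_smul]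

/-! ### Qubit operators acting on qubit and bath -/

section OnQubit

variable {E : Type*} [NormedAddCommGroup E] [InnerProductSpace ℂ E]

theorem onQubit_one : onQubit E 1 = 1 := by
  ext i j : 2
  simp only [onQubit, Matrix.map_apply, Matrix.one_apply]
  split_ifs <;> simp

theorem onQubit_mul (A B : Matrix (Fin 2) (Fin 2) ℂ) :
    onQubit E (A * B) = onQubit E A * onQubit E B := by
  ext i j : 2
  simp only [onQubit, Matrix.map_apply, Matrix.mul_apply, Finset.sum_smul, smul_mul_smul_comm,
    mul_one]

theorem onQubit_add (A B : Matrix (Fin 2) (Fin 2) ℂ) :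
    onQubit E (A + B) = onQubit E A + onQubit E B := by
  ext i j : 2
  simp [onQubit, add_smul]

theorem onQubit_smul (z : ℂ) (A : Matrix (Fin 2) (Fin 2) ℂ) :
    onQubit E (z • A) = z • onQubit E A := by
  ext i j : 2
  simp [onQubit, smul_smul]

theorem star_onQubit [CompleteSpace E] (A : Matrix (Fin 2) (Fin 2) ℂ) :
    star (onQubit E A) = onQubit E Aᴴ := by
  ext i j : 2
  simp [onQubit, Matrix.star_apply, star_smul]

theorem onQubit_mem_unitary [CompleteSpace E] {A : Matrix (Fin 2) (Fin 2) ℂ} (h : Aᴴ * A = 1)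
    (h' : A * Aᴴ = 1) : onQubit E A ∈ unitary (JointOp E) := by
  rw [Unitary.mem_iff, star_onQubit, ← onQubit_mul, ← onQubit_mul, h, h', onQubit_one]
  exact ⟨rfl, rfl⟩

theorem onQubit_pauli_mem_unitary [CompleteSpace E] (o : Axis) :
    onQubit E (pauli o) ∈ unitary (JointOp E) :=
  onQubit_mem_unitary (by rw [pauli_conjTranspose, pauli_mul_self])
    (by rw [pauli_conjTranspose, pauli_mul_self])

theorem onQubit_pauli_mul_self (o : Axis) : onQubit E (pauli o) * onQubit E (pauli o) = 1 := by
  rw [← onQubit_mul, pauli_mul_self, onQubit_one]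

theorem onQubit_yRotation_mem_unitary [CompleteSpace E] (θ : ℝ) :
    onQubit E (yRotation θ) ∈ unitary (JointOp E) := by
  have hc : (rotCoeff θ 0 : ℂ) * (rotCoeff θ 0 : ℂ) + (rotCoeff θ 1 : ℂ) * (rotCoeff θ 1 : ℂ)
      = 1 := by
    norm_cast
    simp only [rotCoeff, Fin.val_zero, Fin.val_one, Nat.cast_zero, Nat.cast_one, zero_mul,
      add_zero, one_mul, Real.cos_add_pi_div_two]
    nlinarith [Real.sin_sq_add_cos_sq (θ / 2)]
  have hs : (yRotation θ)ᴴ = (rotCoeff θ 0 : ℂ) • (1 : Matrix (Fin 2) (Fin 2) ℂ)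
      - ((rotCoeff θ 1 : ℂ) * I) • pauli Axis.y := by
    rw [yRotation_eq, Matrix.conjTranspose_add, Matrix.conjTranspose_smul,
      Matrix.conjTranspose_smul, pauli_conjTranspose, Matrix.conjTranspose_one]
    simp [sub_eq_add_neg]
  apply onQubit_mem_unitary
  all_goals
    rw [hs, yRotation_eq]
    simp only [add_mul, sub_mul, mul_add, mul_sub, smul_mul_smul_comm, mul_one, one_mul,
      pauli_mul_self]
    rw [show (rotCoeff θ 1 : ℂ) * I * ((rotCoeff θ 1 : ℂ) * I)
      = -((rotCoeff θ 1 : ℂ) * (rotCoeff θ 1 : ℂ)) by rw [mul_mul_mul_comm, I_mul_I]; ring,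
      mul_comm ((rotCoeff θ 1 : ℂ) * I)]
    refine Eq.trans ?_ ((congrArg (· • (1 : Matrix (Fin 2) (Fin 2) ℂ)) hc).trans (one_smul ℂ _))
    module

end OnQubit

/-! ### Expansion of the propagator over branches -/

section BranchExpansion

variable {E : Type*} [NormedAddCommGroup E] [InnerProductSpace ℂ E]

/-- `σ_y` exchanges the propagators of opposite couplings. -/
theorem IsTimeOrderedExp.pauli_y_mul [CompleteSpace E] {D : Submodule ℂ E} {X : ℝ → D →ₗ[ℂ] D}
    {y : ℝ → ℝ} {a c : ℝ} {U : ℤˣ → ℝ → ℝ → JointOp E}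
    (hU : ∀ ε : ℤˣ, IsTimeOrderedExp D X
      (fun t => ((((ε : ℤ) : ℝ) * y t : ℝ) : ℂ) • pauli Axis.z) a c (U ε))
    (ε : ℤˣ) {s t : ℝ} (hs : s ∈ Set.Icc a c) (ht : t ∈ Set.Icc a c) :
    onQubit E (pauli Axis.y) * U ε t s = U (-ε) t s * onQubit E (pauli Axis.y) := by
  set S := onQubit E (pauli Axis.y) with hS
  have hSS : S * S = 1 := onQubit_pauli_mul_self _
  have hSu : S ∈ unitary (JointOp E) := onQubit_pauli_mem_unitary _
  -- The two signs, from -ε and from σ_y σ_z σ_y = -σ_z, cancel.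
  have hsol : ∀ s ∈ Set.Icc a c, IsWeakSolution D X
      (fun t => ((((ε : ℤ) : ℝ) * y t : ℝ) : ℂ) • pauli Axis.z) a c
      (fun t => S * U (-ε) t s * S) := fun s hs => by
    refine (((hU (-ε)).propagator.isWeakSolution hs).conj (pauli Axis.y) fun u => ?_).mul_right S
    have h : pauliSign Axis.z Axis.y = -1 := by
      simp [pauliSign, pauli, Matrix.trace_fin_two]
    rw [smul_mul_assoc, pauli_mul_pauli Axis.z Axis.y, h, mul_smul_comm, smul_smul]
    push_cast
    congr 1
    ring
  have hprop : IsPropagator D X (fun t => ((((ε : ℤ) : ℝ) * y t : ℝ) : ℂ) • pauli Axis.z) a c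
      (fun t s => S * U (-ε) t s * S) := by
    refine ⟨fun s hs t ht => ?_, fun t ht => ?_, fun s hs u hu t ht => ?_,
      fun s hs t ht => (hsol s hs).integrable s hs t ht, fun s hs t ht i j φ χ => ?_⟩
    · exact mul_mem (mul_mem hSu ((hU (-ε)).propagator.mem_unitary s hs t ht)) hSu
    · rw [(hU (-ε)).propagator.self t ht, mul_one, hSS]
    · rw [← (hU (-ε)).propagator.comp s hs u hu t ht]
      simp only [mul_assoc]
      rw [← mul_assoc S S, hSS, one_mul]
    · rw [(hsol s hs).eq s hs t ht i j φ χ, (hU (-ε)).propagator.self s hs, mul_one, hSS,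
        one_jointOp_apply]
  rw [← (hU ε).unique _ hprop s hs t ht, ← mul_assoc, ← mul_assoc, hSS, one_mul]

theorem onQubit_pauli_y_pow_mul {V : ℤˣ → JointOp E}
    (hV : ∀ ε, onQubit E (pauli Axis.y) * V ε = V (-ε) * onQubit E (pauli Axis.y)) (n : ℕ) :
    onQubit E (pauli Axis.y ^ n) * V 1 = V ((-1) ^ n) * onQubit E (pauli Axis.y ^ n) := by
  induction n with
  | zero => simp [onQubit_one]
  | succ n ih =>
    rw [pow_succ', onQubit_mul, mul_assoc, ih, ← mul_assoc, hV, mul_assoc, pow_succ']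
    simp

theorem tailWeight_cons_zero {N : ℕ} (a : Fin 2) (r : Fin (N + 1) → Fin 2) :
    tailWeight (Fin.cons a r : Fin (N + 2) → Fin 2) 0 = a + tailWeight r 0 := by
  simp [tailWeight, Fin.sum_univ_succ (n := N + 1)]

theorem tailWeight_cons_succ {N : ℕ} (a : Fin 2) (r : Fin (N + 1) → Fin 2) (k : Fin (N + 1)) :
    tailWeight (Fin.cons a r : Fin (N + 2) → Fin 2) k.succ = tailWeight r k := by
  simp only [tailWeight, Finset.sum_filter]
  rw [Fin.sum_univ_succ]
  simp [Fin.succ_le_succ_iff]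

/-- Expanding each rotation as `c₀ + c₁ i σ_y` and moving all `σ_y` to the right. -/
theorem prod_rotation_eq_sum_branches {N : ℕ} (θ : Fin (N + 1) → ℝ)
    (V : ℤˣ → Fin N → JointOp E)
    (hV : ∀ ε k, onQubit E (pauli Axis.y) * V ε k = V (-ε) k * onQubit E (pauli Axis.y)) :
    ((List.ofFn fun k : Fin N => onQubit E (yRotation (θ k.succ)) * V 1 k).reverse).prod
        * onQubit E (yRotation (θ 0))
      = ∑ r : Fin (N + 1) → Fin 2,
          ((∏ j, (rotCoeff (θ j) (r j) : ℂ)) * I ^ tailWeight r 0) •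
            (((List.ofFn fun k : Fin N => V ((-1) ^ tailWeight r k.succ) k).reverse).prod
              * onQubit E (pauli Axis.y ^ tailWeight r 0)) := by
  have hrot : ∀ θ : ℝ, onQubit E (yRotation θ)
      = ∑ a : Fin 2, ((rotCoeff θ a : ℂ) * I ^ (a : ℕ)) • onQubit E (pauli Axis.y ^ (a : ℕ)) := by
    intro θ
    rw [yRotation_eq, onQubit_add, onQubit_smul, onQubit_smul, Fin.sum_univ_two]
    simp
  induction N with
  | zero =>
    rw [hrot, List.ofFn_zero, List.reverse_nil, List.prod_nil, one_mul,
      ← (Equiv.funUnique (Fin 1) (Fin 2)).symm.sum_comp]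
    refine Finset.sum_congr rfl fun a _ => ?_
    simp [tailWeight, Equiv.funUnique]
  | succ N ih =>
    -- The earliest interval and rotation are split off. The σ_y collected from all later rotations
    -- must cross this interval, which fixes its sign as (-1)^{|r|_1}; only then does θ₀ add its own
    -- power of σ_y.
    have ih' := ih (fun k => θ k.succ) (fun ε k => V ε k.succ) fun ε k => hV ε k.succ
    rw [List.ofFn_succ, List.reverse_cons, List.prod_append, List.prod_singleton,
      ← mul_assoc ((List.ofFn _).reverse.prod), ih',
      ← (Fin.consEquiv fun _ : Fin (N + 2) => Fin 2).sum_comp, Fintype.sum_prod_type,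
      Finset.sum_comm, hrot, Finset.sum_mul, Finset.sum_mul]
    refine Finset.sum_congr rfl fun r _ => ?_
    rw [Finset.mul_sum]
    refine Finset.sum_congr rfl fun a _ => ?_
    have hc : (Fin.consEquiv fun _ : Fin (N + 2) => Fin 2) (a, r)
      = (Fin.cons a r : Fin (N + 2) → Fin 2) := rfl
    rw [hc, Fin.prod_univ_succ (n := N + 1), List.ofFn_succ, List.reverse_cons, List.prod_append,
      List.prod_singleton, tailWeight_cons_zero]
    simp only [tailWeight_cons_succ, Fin.cons_zero, Fin.cons_succ]
    rw [smul_mul_assoc, smul_mul_smul_comm, mul_assoc _ _ (V 1 0),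
      onQubit_pauli_y_pow_mul (fun ε => hV ε 0), add_comm (a : ℕ), pow_add, pow_add, onQubit_mul]
    simp only [mul_assoc]
    congr 1
    ring

theorem totalPropagator_eq_sum [CompleteSpace E] {D : Submodule ℂ E} {X : ℝ → D →ₗ[ℂ] D}
    {y : ℝ → ℝ} {N : ℕ} {tp : Fin (N + 1) → ℝ} (θ : Fin (N + 1) → ℝ) (htp : Monotone tp)
    {U : ℤˣ → ℝ → ℝ → JointOp E}
    (hU : ∀ ε : ℤˣ, IsTimeOrderedExp D X
      (fun t => ((((ε : ℤ) : ℝ) * y t : ℝ) : ℂ) • pauli Axis.z) (tp 0) (tp (Fin.last N)) (U ε)) :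
    totalPropagator tp θ (U 1)
        = ∑ r : Fin (N + 1) → Fin 2,
            ((∏ j, (rotCoeff (θ j) (r j) : ℂ)) * I ^ tailWeight r 0) •
              (branchPropagator tp U r * onQubit E (pauli Axis.y ^ tailWeight r 0)) :=
  prod_rotation_eq_sum_branches θ (fun ε k => U ε (tp k.succ) (tp k.castSucc)) fun ε _ =>
    IsTimeOrderedExp.pauli_y_mul hU ε ⟨htp (Fin.zero_le _), htp (Fin.le_last _)⟩
      ⟨htp (Fin.zero_le _), htp (Fin.le_last _)⟩

theorem list_reverse_prod_mem_unitary [CompleteSpace E] {n : ℕ} {V : Fin n → JointOp E}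
    (hV : ∀ k, V k ∈ unitary (JointOp E)) : (List.ofFn V).reverse.prod ∈ unitary (JointOp E) := by
  refine Submonoid.list_prod_mem _ fun x hx => ?_
  rw [List.mem_reverse, List.mem_ofFn] at hx
  obtain ⟨k, rfl⟩ := hx
  exact hV k

/-- The adjoint puts the power of σ_y of branch r' directly to the right of σ_o⁻¹; moving it to the
far left costs the sign (f_o^y)^{|r'|}. -/
theorem echo_sum_smul [CompleteSpace E] {β : Type*} [Fintype β] (o : Axis) (z : β → ℂ) (w : β → ℕ)
    (V : β → JointOp E) :
    echo o (∑ r, z r • (V r * onQubit E (pauli Axis.y ^ w r)))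
        (∑ r, z r • (V r * onQubit E (pauli Axis.y ^ w r)))
      = ∑ r, ∑ r', (z r * star (z r') * (pauliSign o Axis.y : ℂ) ^ w r') •
          (onQubit E (pauli Axis.y ^ w r') * echo o (V r) (V r')
            * onQubit E (pauli Axis.y ^ w r)) := by
  simp only [echo, star_sum, Finset.mul_sum, Finset.sum_mul]
  refine Finset.sum_congr rfl fun r _ => Finset.sum_congr rfl fun r' _ => ?_
  rw [star_smul, star_mul, star_onQubit, pauli_pow_conjTranspose, pauli_inv, mul_smul_comm,
    mul_smul_comm, smul_mul_assoc, smul_mul_assoc, smul_smul, ← mul_assoc (onQubit E (pauli o)),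
    ← onQubit_mul, pauli_mul_pauli_pow, onQubit_smul, onQubit_mul]
  simp only [smul_mul_assoc, smul_smul, mul_assoc]

end BranchExpansion

namespace Bath

variable {Ω : Type*} [MeasurableSpace Ω] {P : Measure Ω} [IsProbabilityMeasure P] {H : Type*}
  [NormedAddCommGroup H] [InnerProductSpace ℂ H] {ι : Type*} (b : Bath P H ι)

/-! ### Partial expectations -/

theorem norm_vec (k : ι) : ‖(b.vec k : BathSpace P H)‖ = 1 := by
  rw [vec, Lp.norm_const 2 P (b.eigvec k) two_ne_zero]
  simp [b.orthonormal.1 k]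

theorem summable_weight_mul {f : ι → ℂ} {M : ℝ} (hf : ∀ k, ‖f k‖ ≤ M) :
    Summable fun k => (b.weight k : ℂ) * f k := by
  refine Summable.of_norm_bounded (b.weight_sum.summable.mul_right M) fun k => ?_
  rw [norm_mul, norm_real, Real.norm_of_nonneg (b.weight_nonneg k)]
  exact mul_le_mul_of_nonneg_left (hf k) (b.weight_nonneg k)

theorem summable_expect (X : BathSpace P H →L[ℂ] BathSpace P H) :
    Summable fun k => (b.weight k : ℂ) * ⟪(b.vec k : BathSpace P H), X (b.vec k)⟫_ℂ := by
  refine b.summable_weight_mul (M := ‖X‖) fun k => ?_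
  refine (norm_inner_le_norm _ _).trans ?_
  simpa [norm_vec] using X.le_opNorm (b.vec k : BathSpace P H)

theorem hasSum_weight : HasSum (fun k => (b.weight k : ℂ)) 1 := by
  rw [← ofReal_one]
  exact Complex.hasSum_ofReal.2 b.weight_sum

theorem expect_one : b.expect 1 = 1 := by
  simp only [expect, one_apply_eq_self, inner_self_eq_norm_sq_to_K, norm_vec]
  simpa using b.hasSum_weight.tsum_eq

/-- The expectation as a linear functional. -/
def expectLinear : (BathSpace P H →L[ℂ] BathSpace P H) →ₗ[ℂ] ℂ where
  toFun := b.expect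
  map_add' X Y := by
    simp only [expect, add_apply, inner_add_right, mul_add]
    exact (b.summable_expect X).tsum_add (b.summable_expect Y)
  map_smul' z X := by
    simp only [expect, smul_apply, inner_smul_right, RingHom.id_apply,
      smul_eq_mul, ← tsum_mul_left]
    exact tsum_congr fun k => by ring

theorem reduce_apply (X : JointOp (BathSpace P H)) (i j : Fin 2) :
    b.reduce X i j = b.expectLinear (X i j) := rfl

theorem reduce_smul (z : ℂ) (X : JointOp (BathSpace P H)) :
    b.reduce (z • X) = z • b.reduce X := by
  ext i j
  rw [reduce_apply, Matrix.smul_apply, map_smul]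
  rfl

theorem reduce_sum {β : Type*} (s : Finset β) (X : β → JointOp (BathSpace P H)) :
    b.reduce (∑ r ∈ s, X r) = ∑ r ∈ s, b.reduce (X r) := by
  ext i j
  rw [reduce_apply, Matrix.sum_apply, map_sum, Matrix.sum_apply]
  rfl

theorem reduce_onQubit_mul (A : Matrix (Fin 2) (Fin 2) ℂ) (X : JointOp (BathSpace P H)) :
    b.reduce (onQubit (BathSpace P H) A * X) = A * b.reduce X := by
  ext i j
  simp [reduce_apply, Matrix.mul_apply, onQubit, Matrix.map_apply]

theorem reduce_mul_onQubit (X : JointOp (BathSpace P H)) (A : Matrix (Fin 2) (Fin 2) ℂ) :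
    b.reduce (X * onQubit (BathSpace P H) A) = b.reduce X * A := by
  ext i j
  simp [reduce_apply, Matrix.mul_apply, onQubit, Matrix.map_apply, mul_comm]

theorem reduce_one : b.reduce 1 = 1 := by
  ext i j
  rw [reduce_apply, Matrix.one_apply, Matrix.one_apply]
  split_ifs
  · exact b.expect_one
  · exact map_zero _

theorem I_pow_mul_star (m n : ℕ) : I ^ m * star (I ^ n) = I ^ ((m : ℤ) - (n : ℤ)) := by
  rw [zpow_sub₀ I_ne_zero, zpow_natCast, zpow_natCast, div_eq_mul_inv, star_pow, ← inv_pow, inv_I]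
  simp

theorem reduce_echo_eq_sum [CompleteSpace H] {N : ℕ} (o : Axis) (z : (Fin (N + 1) → Fin 2) → ℝ)
    (w : (Fin (N + 1) → Fin 2) → ℕ) (V : (Fin (N + 1) → Fin 2) → JointOp (BathSpace P H))
    {U : JointOp (BathSpace P H)}
    (hU : U = ∑ r, ((z r : ℂ) * I ^ w r) • (V r * onQubit (BathSpace P H) (pauli Axis.y ^ w r))) :
    b.reduce (echo o U U)
      = ∑ r, ∑ r', (I ^ ((w r : ℤ) - (w r' : ℤ)) * ((z r' : ℂ) * (z r : ℂ))
          * (pauliSign o Axis.y : ℂ) ^ w r') •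
          (pauli Axis.y ^ w r' * b.reduce (echo o (V r) (V r')) * pauli Axis.y ^ w r) := by
  rw [hU, echo_sum_smul, reduce_sum]
  refine Finset.sum_congr rfl fun r _ => ?_
  rw [reduce_sum]
  refine Finset.sum_congr rfl fun r' _ => ?_
  rw [reduce_smul, reduce_mul_onQubit, reduce_onQubit_mul, ← I_pow_mul_star, star_mul']
  congr 2
  simp only [RCLike.star_def, conj_ofReal]
  ring

/-! ### The reduced state -/

/-- The passage from the Schrödinger to the Heisenberg picture: ⟪U j d ψ, U i c ψ⟫ is the
expectation of (U†) d j (U i c) in ψ. -/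
theorem trace_reducedState_mul [CompleteSpace H] (U : JointOp (BathSpace P H))
    (ρ S : Matrix (Fin 2) (Fin 2) ℂ) :
    (b.reducedState U ρ * S).trace
      = (b.reduce (star U * onQubit (BathSpace P H) S * U) * ρ).trace := by
  have h : ∀ i j, b.reducedState U ρ i j
      = ∑ c, ∑ d, ρ c d * b.expectLinear (star U d j * U i c) := by
    intro i j
    rw [reducedState, Matrix.of_apply]
    refine Finset.sum_congr rfl fun c _ => Finset.sum_congr rfl fun d _ => ?_
    congr 1
    refine tsum_congr fun k => ?_
    rw [Matrix.star_apply, ContinuousLinearMap.star_eq_adjoint, mul_apply_eq_comp,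
      ContinuousLinearMap.adjoint_inner_right]
  have h' : ∀ d c, b.reduce (star U * onQubit (BathSpace P H) S * U) d c
      = ∑ i, ∑ j, S j i * b.expectLinear (star U d j * U i c) := by
    intro d c
    rw [reduce_apply]
    simp [Matrix.mul_apply, Fin.sum_univ_two, onQubit, add_mul]
  simp only [Matrix.trace, Matrix.diag, Matrix.mul_apply, h, h', Fin.sum_univ_two]
  ring

theorem trace_reducedState [CompleteSpace H] {U : JointOp (BathSpace P H)}
    (hU : U ∈ unitary (JointOp (BathSpace P H))) (ρ : Matrix (Fin 2) (Fin 2) ℂ) :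
    (b.reducedState U ρ).trace = ρ.trace := by
  have h := b.trace_reducedState_mul U ρ 1
  rwa [mul_one, onQubit_one, mul_one, (Unitary.mem_iff.1 hU).1, reduce_one, one_mul] at h

/-- The factor σ_o⁻¹ in `echo` cancels the final σ_o by cyclicity of the trace. -/
theorem trace_reducedState_mul_pauli [CompleteSpace H] (U : JointOp (BathSpace P H))
    (ρ : Matrix (Fin 2) (Fin 2) ℂ) (o : Axis) :
    (b.reducedState U ρ * pauli o).trace = (b.reduce (echo o U U) * ρ * pauli o).trace := by
  have h : echo o U U = onQubit (BathSpace P H) (pauli o)⁻¹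
      * (star U * onQubit (BathSpace P H) (pauli o) * U) := by
    simp only [echo, mul_assoc]
  rw [trace_reducedState_mul, h, reduce_onQubit_mul, pauli_inv, Matrix.trace_mul_comm _ (pauli o),
    ← mul_assoc, ← mul_assoc, pauli_mul_self, one_mul]

theorem eq_pauli_expansion {M : Matrix (Fin 2) (Fin 2) ℂ} (hM : M.trace = 1) :
    M = (1 / 2 : ℂ) • (1 + (M * pauli Axis.x).trace • pauli Axis.x
      + (M * pauli Axis.y).trace • pauli Axis.y + (M * pauli Axis.z).trace • pauli Axis.z) := by
  have h2 : M 0 0 + M 1 1 = 1 := by rw [← hM, Matrix.trace_fin_two]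
  ext i j
  fin_cases i <;> fin_cases j <;>
    simp [Matrix.trace_fin_two, Matrix.mul_apply, Fin.sum_univ_two, pauli]
  · linear_combination (1 / 2 : ℂ) * h2
  · linear_combination ((M 0 1 - M 1 0) / 2 : ℂ) * I_sq
  · linear_combination ((M 1 0 - M 0 1) / 2 : ℂ) * I_sq
  · linear_combination (1 / 2 : ℂ) * h2

end Bath

/-! ### The hierarchy of moments under a Gaussian evolution -/

/-- The only slowly growing solution of the homogeneous hierarchy
`D_l(t) = ∫ₐᵗ κ(u) D_{τ(u) :: l}(u) du` is zero. -/
theorem hierarchy_eq_zero {D : List ℝ → ℝ → ℂ} {κ : ℝ → ℂ} {τ : ℝ → ℝ} {a c M R : ℝ}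
    (hκ : ∀ u, ‖κ u‖ ≤ 1)
    (hD : ∀ l, ∀ t ∈ Set.Icc a c, ‖D l t‖ ≤ M * (R ^ l.length * √(l.length.factorial)))
    (hrec : ∀ l, ∀ t ∈ Set.Icc a c, D l t = ∫ u in a..t, κ u * D (τ u :: l) u)
    {t : ℝ} (ht : t ∈ Set.Icc a c) (hR : 0 ≤ R) : D [] t = 0 := by
  -- After n iterations: the a priori bound for words longer by n, times the volume (t - a)ⁿ / n! of
  -- the simplex of intermediate times.
  have key : ∀ n : ℕ, ∀ l, ∀ t ∈ Set.Icc a c,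
      ‖D l t‖ ≤ M * (R ^ (l.length + n) * √((l.length + n).factorial))
        * ((t - a) ^ n / n.factorial) := by
    intro n
    induction n with
    | zero => intro l t ht; simpa using hD l t ht
    | succ n ih =>
      intro l t ht
      set K := M * (R ^ (l.length + (n + 1)) * √((l.length + (n + 1)).factorial)) with hK
      have hb : ∀ u ∈ Set.Ioc a t, ‖κ u * D (τ u :: l) u‖ ≤ K * ((u - a) ^ n / n.factorial) := by
        intro u hu
        have h1 := ih (τ u :: l) u ⟨hu.1.le, hu.2.trans ht.2⟩
        rw [List.length_cons, add_right_comm, add_assoc] at h1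
        rw [norm_mul]
        exact (mul_le_of_le_one_left (norm_nonneg _) (hκ u)).trans h1
      rw [hrec l t ht]
      have hcont : Continuous fun u : ℝ => K * ((u - a) ^ n / n.factorial) := by fun_prop
      refine (intervalIntegral.norm_integral_le_of_norm_le ht.1 (ae_of_all _ hb)
        (hcont.intervalIntegrable _ _)).trans_eq ?_
      rw [intervalIntegral.integral_const_mul, intervalIntegral.integral_div,
        intervalIntegral.integral_comp_sub_right (fun u => u ^ n) a, integral_pow, sub_self,
        zero_pow (Nat.succ_ne_zero n), Nat.factorial_succ n]
      push_cast
      field_simp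
      simp
  -- For the empty word √n! / n! = 1 / √n!, so the bound is M times the square root of the n-th term
  -- of an exponential series.
  have hlim : Filter.Tendsto (fun n : ℕ => M * √(((R * (t - a)) ^ 2) ^ n / n.factorial))
      Filter.atTop (nhds 0) := by
    have := ((FloorSemiring.tendsto_pow_div_factorial_atTop ((R * (t - a)) ^ 2)).sqrt).const_mul M
    simpa using this
  have hle : ∀ n : ℕ, ‖D [] t‖ ≤ M * √(((R * (t - a)) ^ 2) ^ n / n.factorial) := by
    intro n
    refine (key n [] t ht).trans_eq ?_
    have hx : 0 ≤ R * (t - a) := mul_nonneg hR (sub_nonneg.2 ht.1)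
    have hn : (0 : ℝ) < n.factorial := by positivity
    rw [Real.sqrt_div (by positivity), ← pow_mul, mul_comm 2 n, pow_mul,
      Real.sqrt_sq (by positivity), mul_pow]
    simp only [List.length_nil, zero_add]
    have hs : √(n.factorial : ℝ) / n.factorial = 1 / √(n.factorial : ℝ) := Real.sqrt_div_self'
    calc _ = M * (R ^ n * (t - a) ^ n * (√(n.factorial : ℝ) / n.factorial)) := by ring
      _ = _ := by rw [hs]; ring
  exact norm_le_zero_iff.1 (ge_of_tendsto' hlim hle)

/-! ### An explicit solution of the hierarchy. -/

section GaussianFlow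

variable {c : ℝ → ℝ → ℂ} {τ : ℝ → ℝ} {κ : ℝ → ℂ} {a : ℝ} {C : ℝ}

/-- The mean acquired by a Gaussian process under the evolution up to time `t`. -/
def driftMean (c : ℝ → ℝ → ℂ) (τ : ℝ → ℝ) (κ : ℝ → ℂ) (a t x : ℝ) : ℂ :=
  ∫ u in a..t, κ u * c x (τ u)

/-- The logarithm of the expectation of a Gaussian evolution. -/
def gaussianExponent (c : ℝ → ℝ → ℂ) (τ : ℝ → ℝ) (κ : ℝ → ℂ) (a t : ℝ) : ℂ :=
  ∫ u in a..t, κ u * driftMean c τ κ a u (τ u)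

theorem intervalIntegrable_of_measurable_of_norm_le (hκm : Measurable κ) (hκ : ∀ u, ‖κ u‖ ≤ 1)
    (s t : ℝ) : IntervalIntegrable κ volume s t :=
  (intervalIntegrable_const (c := (1 : ℝ))).mono_fun hκm.aestronglyMeasurable
    (ae_of_all _ fun u => by simpa using hκ u)

/-- Joint continuity is needed because the mean is evaluated along curves such as x = τ t, where
both variables move. It follows by dominated convergence with the constant bound C. -/
theorem continuous_driftMean (hc : Continuous (Function.uncurry c)) (hC : ∀ x y, ‖c x y‖ ≤ C)
    (hτ : Continuous τ) (hκm : Measurable κ) (hκ : ∀ u, ‖κ u‖ ≤ 1) :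
    Continuous fun p : ℝ × ℝ => driftMean c τ κ a p.2 p.1 := by
  rw [continuous_iff_continuousAt]
  rintro ⟨x₀, t₀⟩
  have hcx : ∀ x, Continuous fun u => c x (τ u) := fun x =>
    hc.comp (continuous_const.prodMk hτ)
  refine intervalIntegral.continuousAt_parametric_primitive_of_dominated
    (F := fun x u => κ u * c x (τ u)) (fun _ => C) (min a t₀ - 1) (max a t₀ + 1) (fun x => ?_)
    (Filter.Eventually.of_forall fun x => ae_of_all _ fun u => ?_) intervalIntegrable_const
    (ae_of_all _ fun u => ?_) ⟨?_, ?_⟩ ⟨?_, ?_⟩ (by simp)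
  · exact (hκm.mul (hcx x).measurable).aestronglyMeasurable
  · rw [norm_mul]
    exact (mul_le_of_le_one_left (norm_nonneg _) (hκ u)).trans (hC _ _)
  · exact (continuous_const.mul
      (hc.comp (continuous_id.prodMk continuous_const))).continuousAt
  · linarith [min_le_left a t₀]
  · linarith [le_max_left a t₀]
  · linarith [min_le_right a t₀]
  · linarith [le_max_right a t₀]

theorem hasDerivAt_integral_mul {f : ℝ → ℂ} (hκm : Measurable κ) (hκ : ∀ u, ‖κ u‖ ≤ 1)
    (hf : Continuous f) {t : ℝ} (ht : ContinuousAt κ t) :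
    HasDerivAt (fun t => ∫ u in a..t, κ u * f u) (κ t * f t) t :=
  intervalIntegral.integral_hasDerivAt_right
    ((intervalIntegrable_of_measurable_of_norm_le hκm hκ a t).mul_continuousOn hf.continuousOn)
    (hκm.mul hf.measurable).stronglyMeasurable.stronglyMeasurableAtFilter
    (ht.mul hf.continuousAt)

theorem norm_driftMean_le (hC : ∀ x y, ‖c x y‖ ≤ C) (hκ : ∀ u, ‖κ u‖ ≤ 1) {t c' : ℝ}
    (ht : t ∈ Set.Icc a c') (x : ℝ) : ‖driftMean c τ κ a t x‖ ≤ C * (c' - a) := by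
  have hC0 : 0 ≤ C := (norm_nonneg _).trans (hC 0 0)
  refine (intervalIntegral.norm_integral_le_of_norm_le_const (C := C) fun u _ => ?_).trans ?_
  · rw [norm_mul]
    exact (mul_le_of_le_one_left (norm_nonneg _) (hκ u)).trans (hC _ _)
  · rw [abs_of_nonneg (sub_nonneg.2 ht.1)]
    exact mul_le_mul_of_nonneg_left (by linarith [ht.2]) hC0

theorem norm_gaussianExponent_le (hC : ∀ x y, ‖c x y‖ ≤ C) (hκ : ∀ u, ‖κ u‖ ≤ 1) {t c' : ℝ}
    (ht : t ∈ Set.Icc a c') : ‖gaussianExponent c τ κ a t‖ ≤ C * (c' - a) * (c' - a) := by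
  have hC0 : 0 ≤ C := (norm_nonneg _).trans (hC 0 0)
  have hac : 0 ≤ c' - a := by linarith [ht.1, ht.2]
  refine (intervalIntegral.norm_integral_le_of_norm_le_const (C := C * (c' - a))
    fun u hu => ?_).trans ?_
  · rw [Set.uIoc_of_le ht.1] at hu
    rw [norm_mul]
    exact (mul_le_of_le_one_left (norm_nonneg _) (hκ u)).trans
      (norm_driftMean_le hC hκ ⟨hu.1.le, hu.2.trans ht.2⟩ _)
  · rw [abs_of_nonneg (sub_nonneg.2 ht.1)]
    exact mul_le_mul_of_nonneg_left (by linarith [ht.2]) (by positivity)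

/-- The moments of a Gaussian process weighted by a Gaussian evolution. -/
def gaussianFlow (c : ℝ → ℝ → ℂ) (τ : ℝ → ℝ) (κ : ℝ → ℂ) (a : ℝ) (l : List ℝ) (t : ℝ) : ℂ :=
  exp (gaussianExponent c τ κ a t) * wickShift c (driftMean c τ κ a t) l.reverse

theorem gaussianFlow_self (l : List ℝ) : gaussianFlow c τ κ a l a = wick c l.reverse := by
  have h : driftMean c τ κ a a = 0 := by
    ext x
    simp [driftMean]
  rw [gaussianFlow, h, wickShift_zero]
  simp [gaussianExponent]

theorem norm_gaussianFlow_le (hC : ∀ x y, ‖c x y‖ ≤ C) (hκ : ∀ u, ‖κ u‖ ≤ 1) {R c' : ℝ}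
    (hR : 1 ≤ R) (hKC : C * (c' - a) + C ≤ R) (l : List ℝ) {t : ℝ} (ht : t ∈ Set.Icc a c') :
    ‖gaussianFlow c τ κ a l t‖
      ≤ Real.exp (C * (c' - a) * (c' - a)) * (R ^ l.length * √(l.length.factorial)) := by
  rw [gaussianFlow, norm_mul]
  refine mul_le_mul ?_ ?_ (norm_nonneg _) (Real.exp_nonneg _)
  · rw [norm_exp]
    exact Real.exp_le_exp.2 ((re_le_norm _).trans (norm_gaussianExponent_le hC hκ ht))
  · simpa using norm_wickShift_le hC (norm_driftMean_le hC hκ ht) hR hKC l.reverse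

/-- Differentiating the exponential brings down κ(u) times the mean at τ(u); differentiating the
mean gives κ(u) c(x, τ(u)) at each unpaired x. These are κ(u) times the two terms of
`wickShift_append_singleton` for the word enlarged by τ(u). Since κ may jump on the countable set S,
the fundamental theorem of calculus is used with derivatives off S and continuity everywhere. -/
theorem gaussianFlow_eq (hc : Continuous (Function.uncurry c)) (hC : ∀ x y, ‖c x y‖ ≤ C)
    (hτ : Continuous τ) (hκm : Measurable κ) (hκ : ∀ u, ‖κ u‖ ≤ 1) {S : Set ℝ}
    (hS : S.Countable) (hκc : ∀ u, u ∉ S → ContinuousAt κ u) (l : List ℝ) (t : ℝ) :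
    IntervalIntegrable (fun u => κ u * gaussianFlow c τ κ a (τ u :: l) u) volume a t
    ∧ gaussianFlow c τ κ a l t
      = wick c l.reverse + ∫ u in a..t, κ u * gaussianFlow c τ κ a (τ u :: l) u := by
  have hcx : ∀ x, Continuous fun u => c x (τ u) := fun x =>
    hc.comp (continuous_const.prodMk hτ)
  have hdrift := continuous_driftMean (a := a) hc hC hτ hκm hκ
  have hdiag : Continuous fun u => driftMean c τ κ a u (τ u) :=
    hdrift.comp (hτ.prodMk continuous_id)
  have hdx : ∀ x, Continuous fun u => driftMean c τ κ a u x := fun x =>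
    hdrift.comp (continuous_const.prodMk continuous_id)
  have hwick : ∀ m, Continuous fun u => wickShift c (driftMean c τ κ a u) m := fun m =>
    continuous_iff_continuousAt.2 fun u =>
      continuousAt_wickShift c (fun x => (hdx x).continuousAt) m
  have hexp : Continuous fun u => exp (gaussianExponent c τ κ a u) := by
    refine continuous_exp.comp ?_
    refine intervalIntegral.continuous_primitive (fun s t => ?_) a
    exact (intervalIntegrable_of_measurable_of_norm_le hκm hκ s t).mul_continuousOn
      hdiag.continuousOn
  have hnext : ∀ u, gaussianFlow c τ κ a (τ u :: l) u
      = exp (gaussianExponent c τ κ a u)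
        * (driftMean c τ κ a u (τ u) * wickShift c (driftMean c τ κ a u) l.reverse
          + sumPick l.reverse
            (fun x r => c x (τ u) * wickShift c (driftMean c τ κ a u) r)) := fun u => by
    rw [gaussianFlow, List.reverse_cons, wickShift_append_singleton]
  have hcont : Continuous fun u => gaussianFlow c τ κ a (τ u :: l) u := by
    simp only [hnext]
    refine hexp.mul ((hdiag.mul (hwick _)).add ?_)
    exact continuous_iff_continuousAt.2 fun u => continuousAt_sumPick fun x r _ =>
      ((hcx x).mul (hwick r)).continuousAt
  have hint : IntervalIntegrable (fun u => κ u * gaussianFlow c τ κ a (τ u :: l) u) volume a t :=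
    (intervalIntegrable_of_measurable_of_norm_le hκm hκ a t).mul_continuousOn hcont.continuousOn
  refine ⟨hint, ?_⟩
  rw [integral_eq_of_hasDerivAt_off_countable (fun u => gaussianFlow c τ κ a l u) _ hS
    (hexp.mul (hwick _)).continuousOn (fun u hu => ?_) hint, gaussianFlow_self]
  · ring
  · have h1 : HasDerivAt (gaussianExponent c τ κ a) (κ u * driftMean c τ κ a u (τ u)) u :=
      hasDerivAt_integral_mul hκm hκ hdiag (hκc u hu.2)
    have h2 := h1.cexp.mul (hasDerivAt_wickShift c
      (fun x => hasDerivAt_integral_mul (a := a) hκm hκ (hcx x) (hκc u hu.2)) l.reverse)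
    refine HasDerivAt.congr_deriv (f := fun u => gaussianFlow c τ κ a l u) h2 ?_
    rw [hnext]
    have h3 : sumPick l.reverse (fun x r => κ u * c x (τ u)
          * wickShift c (fun x => ∫ u in a..u, κ u * c x (τ u)) r)
        = κ u * sumPick l.reverse
          (fun x r => c x (τ u) * wickShift c (driftMean c τ κ a u) r) := by
      rw [mul_sumPick]
      exact sumPick_congr fun x r _ => mul_assoc _ _ _
    rw [h3]
    change _ * wickShift c (driftMean c τ κ a u) l.reverse + _ = _
    ring

end GaussianFlow

/-! ### Moments of the bath operators -/

theorem opWord_append {E : Type*} [NormedAddCommGroup E] [InnerProductSpace ℂ E]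
    {D : Submodule ℂ E} (X : ℝ → D →ₗ[ℂ] D) (l m : List ℝ) (φ : D) :
    opWord X (l ++ m) φ = opWord X l (opWord X m φ) := by
  induction l with
  | nil => rfl
  | cons t l ih => rw [List.cons_append, opWord, ih, opWord]

namespace Bath

variable {Ω : Type*} [MeasurableSpace Ω] {P : Measure Ω} [IsProbabilityMeasure P] {H : Type*}
  [NormedAddCommGroup H] [InnerProductSpace ℂ H] {ι : Type*} (b : Bath P H ι)

theorem inner_opWord_reverse (l : List ℝ) (φ χ : b.dom) :
    ⟪(opWord b.B l.reverse φ : BathSpace P H), (χ : BathSpace P H)⟫_ℂ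
      = ⟪(φ : BathSpace P H), (opWord b.B l χ : BathSpace P H)⟫_ℂ := by
  induction l generalizing φ with
  | nil => rfl
  | cons t l ih =>
    rw [List.reverse_cons, opWord_append, ih]
    exact b.symmetric t φ _

theorem moment_reverse (l : List ℝ) : b.moment l.reverse = ∑' k, (b.weight k : ℂ)
    * ⟪(opWord b.B l (b.vec k) : BathSpace P H), (b.vec k : BathSpace P H)⟫_ℂ := by
  refine tsum_congr fun k => ?_
  rw [← inner_opWord_reverse, List.reverse_reverse]

theorem moment_reverse_append (l m : List ℝ) : b.moment (l.reverse ++ m) = ∑' k, (b.weight k : ℂ)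
    * ⟪(opWord b.B l (b.vec k) : BathSpace P H), (opWord b.B m (b.vec k) : BathSpace P H)⟫_ℂ := by
  refine tsum_congr fun k => ?_
  rw [opWord_append, ← inner_opWord_reverse, List.reverse_reverse]

/-- By symmetry of the operators the squared norm of a word vector is the expectation of a
palindrome, so Wick's formula controls it. -/
theorem ofReal_tsum_sq_norm (l : List ℝ) :
    ((∑' k, b.weight k * ‖(opWord b.B l (b.vec k) : BathSpace P H)‖ ^ 2 : ℝ) : ℂ)
      = b.moment (l.reverse ++ l) := by
  rw [moment_reverse_append, ofReal_tsum]
  refine tsum_congr fun k => ?_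
  rw [inner_self_eq_norm_sq_to_K]
  push_cast
  rfl

theorem conj_corr (t t' : ℝ) : star (b.corr t t') = b.corr t' t := by
  rw [corr, corr, moment, moment, tsum_star]
  refine tsum_congr fun k => ?_
  rw [star_mul', RCLike.star_def, conj_ofReal, inner_conj_symm]
  congr 1
  exact b.inner_opWord_reverse [t', t] (b.vec k) (b.vec k)

theorem summable_sq_norm (l : List ℝ) :
    Summable fun k => b.weight k * ‖(opWord b.B l (b.vec k) : BathSpace P H)‖ ^ 2 :=
  b.finite_moments l

/-- By stationarity the two-point function is bounded by the variance. -/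
theorem norm_corr_le (hstat : b.IsStationary) (t t' : ℝ) : ‖b.corr t t'‖ ≤ ‖b.corr 0 0‖ := by
  have hsq : ∀ t, ∑' k, b.weight k * ‖(opWord b.B [t] (b.vec k) : BathSpace P H)‖ ^ 2
      = ‖b.corr 0 0‖ := by
    intro t
    have h := b.ofReal_tsum_sq_norm [t]
    have h' : b.moment ([t].reverse ++ [t]) = b.corr 0 0 := by
      change b.corr t t = _
      rw [hstat, sub_self]
    rw [← h', ← h, norm_real, Real.norm_of_nonneg]
    exact tsum_nonneg fun k => mul_nonneg (b.weight_nonneg k) (sq_nonneg _)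
  have hmom : b.corr t t' = ∑' k, (b.weight k : ℂ) * ⟪(opWord b.B [t] (b.vec k) : BathSpace P H),
      (opWord b.B [t'] (b.vec k) : BathSpace P H)⟫_ℂ := b.moment_reverse_append [t] [t']
  have hsum := ((b.summable_sq_norm [t]).hasSum.add (b.summable_sq_norm [t']).hasSum).div_const 2
  rw [hsq, hsq, add_self_div_two] at hsum
  rw [hmom]
  refine tsum_of_norm_bounded hsum fun k => ?_
  rw [norm_mul, norm_real, Real.norm_of_nonneg (b.weight_nonneg k), ← mul_add, mul_div_assoc]
  refine mul_le_mul_of_nonneg_left ((norm_inner_le_norm _ _).trans ?_) (b.weight_nonneg k)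
  linarith [two_mul_le_add_sq ‖(opWord b.B [t] (b.vec k) : BathSpace P H)‖
    ‖(opWord b.B [t'] (b.vec k) : BathSpace P H)‖]

theorem continuous_corr (hstat : b.IsStationary) (hcont : Continuous fun τ : ℝ => b.corr τ 0) :
    Continuous (Function.uncurry b.corr) := by
  have h : Function.uncurry b.corr = fun p : ℝ × ℝ => b.corr (p.1 - p.2) 0 :=
    funext fun p => hstat p.1 p.2
  rw [h]
  exact hcont.comp (continuous_fst.sub continuous_snd)

/-- The palindrome has length 2n, so the Wick bound is R²ⁿ √(2n)!, and (2n)! ≤ 4ⁿ (n!)². A further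
factor 2ⁿ is given away to reach a perfect square. -/
theorem tsum_sq_norm_le (hgauss : b.IsGaussian) (hstat : b.IsStationary) {R : ℝ} (hR : 1 ≤ R)
    (hCR : ‖b.corr 0 0‖ ≤ R) (l : List ℝ) :
    ∑' k, b.weight k * ‖(opWord b.B l (b.vec k) : BathSpace P H)‖ ^ 2
      ≤ ((2 * R) ^ l.length * √(l.length.factorial)) ^ 2 := by
  have h1 : ∑' k, b.weight k * ‖(opWord b.B l (b.vec k) : BathSpace P H)‖ ^ 2
      ≤ R ^ (l.length + l.length) * √((l.length + l.length).factorial) := by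
    have h := norm_wickShift_le (h := 0) (K := 0) (b.norm_corr_le hstat) (fun _ => by simp) hR
      (by simpa using hCR) (l.reverse ++ l)
    rw [wickShift_zero, ← hgauss, ← ofReal_tsum_sq_norm, norm_real, List.length_append,
      List.length_reverse] at h
    exact (Real.le_norm_self _).trans h
  have h2 : √((l.length + l.length).factorial : ℝ) ≤ 2 ^ l.length * (l.length.factorial : ℝ) := by
    rw [Real.sqrt_le_left (by positivity)]
    rw [← Nat.add_choose_mul_factorial_mul_factorial l.length l.length]
    have h3 : ((l.length + l.length).choose l.length : ℝ) ≤ 2 ^ (l.length + l.length) := by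
      exact_mod_cast Nat.choose_le_two_pow _ _
    push_cast
    calc _ ≤ (2 : ℝ) ^ (l.length + l.length) * l.length.factorial * l.length.factorial := by gcongr
      _ = _ := by ring
  refine h1.trans ?_
  rw [mul_pow, Real.sq_sqrt (by positivity)]
  calc _ ≤ R ^ (l.length + l.length) * (2 ^ l.length * (l.length.factorial : ℝ)) := by gcongr
    _ ≤ R ^ (l.length + l.length)
        * (2 ^ l.length * (2 ^ l.length * (l.length.factorial : ℝ))) := by
      gcongr
      exact le_mul_of_one_le_left (by positivity) (one_le_pow₀ one_le_two)
    _ = _ := by ring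

theorem summable_norm (l : List ℝ) :
    Summable fun k => b.weight k * ‖(opWord b.B l (b.vec k) : BathSpace P H)‖ := by
  refine Summable.of_nonneg_of_le (fun k => mul_nonneg (b.weight_nonneg k) (norm_nonneg _))
    (fun k => ?_) ((b.summable_sq_norm l).add b.weight_sum.summable)
  rw [← mul_add_one]
  refine mul_le_mul_of_nonneg_left ?_ (b.weight_nonneg k)
  nlinarith [sq_nonneg (‖(opWord b.B l (b.vec k) : BathSpace P H)‖ - 1),
    norm_nonneg (opWord b.B l (b.vec k) : BathSpace P H)]

/-- Cauchy-Schwarz against the probability weights, obtained termwise from x ≤ (x² / M + M) / 2. -/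
theorem tsum_norm_le {l : List ℝ} {M : ℝ} (hM : 0 < M)
    (h : ∑' k, b.weight k * ‖(opWord b.B l (b.vec k) : BathSpace P H)‖ ^ 2 ≤ M ^ 2) :
    ∑' k, b.weight k * ‖(opWord b.B l (b.vec k) : BathSpace P H)‖ ≤ M := by
  have hsum := (((b.summable_sq_norm l).hasSum.div_const M).add
    (b.weight_sum.mul_right M)).div_const 2
  refine (hasSum_le (fun k => ?_) (b.summable_norm l).hasSum hsum).trans ?_
  · set x := ‖(opWord b.B l (b.vec k) : BathSpace P H)‖
    rw [mul_div_assoc, ← mul_add, mul_div_assoc]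
    refine mul_le_mul_of_nonneg_left ?_ (b.weight_nonneg k)
    rw [le_div_iff₀ two_pos, ← sub_nonneg]
    have : x ^ 2 / M + M - x * 2 = (x - M) ^ 2 / M := by field_simp; ring
    rw [this]
    positivity
  · have : (∑' k, b.weight k * ‖(opWord b.B l (b.vec k) : BathSpace P H)‖ ^ 2) / M ≤ M := by
      rw [div_le_iff₀ hM, ← sq]
      exact h
    linarith

end Bath

/-! ### Exchanging sums and integrals -/

theorem tsum_intervalIntegral_of_countable {ι : Type*} [Countable ι] {f : ι → ℝ → ℂ} {a t M : ℝ}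
    (hat : a ≤ t) (hf : ∀ k, IntervalIntegrable (f k) volume a t)
    (hM : ∀ u ∈ Set.Ioc a t, Summable (fun k => ‖f k u‖) ∧ ∑' k, ‖f k u‖ ≤ M) :
    IntervalIntegrable (fun u => ∑' k, f k u) volume a t
      ∧ ∑' k, ∫ u in a..t, f k u = ∫ u in a..t, ∑' k, f k u := by
  simp only [intervalIntegrable_iff_integrableOn_Ioc_of_le hat,
    intervalIntegral.integral_of_le hat] at hf ⊢
  have hMae : ∀ᵐ u ∂volume.restrict (Set.Ioc a t),
      Summable (fun k => ‖f k u‖) ∧ ∑' k, ‖f k u‖ ≤ M :=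
    (ae_restrict_iff' measurableSet_Ioc).2 (ae_of_all _ hM)
  have hmeas : AEStronglyMeasurable (fun u => ∑' k, f k u) (volume.restrict (Set.Ioc a t)) := by
    refine aestronglyMeasurable_of_tendsto_ae Filter.atTop
      (f := fun (s : Finset ι) u => ∑ k ∈ s, f k u) (fun s => ?_) ?_
    · exact (integrable_finsetSum s fun k _ => hf k).aestronglyMeasurable
    · filter_upwards [hMae] with u hu
      exact hu.1.of_norm.hasSum
  constructor
  · refine (integrable_const M).mono' hmeas ?_
    filter_upwards [hMae] with u hu
    exact (norm_tsum_le_tsum_norm hu.1).trans hu.2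
  · refine (hasSum_integral_of_summable_integral_norm hf ?_).tsum_eq
    refine summable_of_sum_le (c := ∫ _ in Set.Ioc a t, M) (fun k => integral_nonneg fun _ =>
      norm_nonneg _) fun s => ?_
    rw [← integral_finsetSum s fun k _ => (hf k).norm]
    refine integral_mono_ae (integrable_finsetSum s fun k _ => (hf k).norm)
      (integrable_const M) ?_
    filter_upwards [hMae] with u hu
    exact (hu.1.sum_le_tsum s fun _ _ => norm_nonneg _).trans hu.2

/-- The index type is arbitrary, but summable weights have countable support, and the terms outside
it vanish. -/
theorem tsum_intervalIntegral_of_support {ι : Type*} {p : ι → ℝ} (hp : Summable p)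
    {f : ι → ℝ → ℂ} {a t M : ℝ} (hpf : ∀ k, p k = 0 → ∀ u, f k u = 0)
    (hat : a ≤ t) (hf : ∀ k, IntervalIntegrable (f k) volume a t)
    (hM : ∀ u ∈ Set.Ioc a t, Summable (fun k => ‖f k u‖) ∧ ∑' k, ‖f k u‖ ≤ M) :
    IntervalIntegrable (fun u => ∑' k, f k u) volume a t
      ∧ ∑' k, ∫ u in a..t, f k u = ∫ u in a..t, ∑' k, f k u := by
  have hcount : Countable (Function.support p) := hp.countable_support.to_subtype
  have h1 : ∀ u, ∑' k : Function.support p, f k u = ∑' k, f k u := fun u =>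
    tsum_subtype_eq_of_support_subset fun k hk hk' => hk (hpf k hk' u)
  have h2 : ∀ u, ∑' k : Function.support p, ‖f k u‖ = ∑' k, ‖f k u‖ := fun u =>
    tsum_subtype_eq_of_support_subset (f := fun k => ‖f k u‖)
      fun k hk hk' => hk (by simp [hpf k hk' u])
  have h3 : ∑' k : Function.support p, ∫ u in a..t, f k u = ∑' k, ∫ u in a..t, f k u :=
    tsum_subtype_eq_of_support_subset (f := fun k => ∫ u in a..t, f k u)
      fun k hk hk' => hk (by simp [hpf k hk'])
  have := tsum_intervalIntegral_of_countable (f := fun (k : Function.support p) u => f k u) hat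
    (fun k => hf k) (M := M) fun u hu => ⟨(hM u hu).1.subtype _, (h2 u).trans_le (hM u hu).2⟩
  simpa only [h1, h3] using this

/-! ### Reduced dynamics of a Gaussian dephasing Hamiltonian -/

/-- Each column of a unitary operator matrix is an isometry: the squared norms of V n j χ over n add
up to that of χ. -/
theorem norm_unitary_entry_apply_le {E : Type*} [NormedAddCommGroup E] [InnerProductSpace ℂ E]
    [CompleteSpace E] {V : JointOp E} (hV : V ∈ unitary (JointOp E)) (i j : Fin 2) (χ : E) :
    ‖V i j χ‖ ≤ ‖χ‖ := by
  have h1 : ∑ n, (‖V n j χ‖ : ℂ) ^ 2 = (‖χ‖ : ℂ) ^ 2 := by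
    have h2 := congrArg (fun M : JointOp E => ⟪χ, M j j χ⟫_ℂ) (Unitary.mem_iff.1 hV).1
    simp only [jointOp_mul_apply, one_jointOp_apply, if_true, inner_sum, Matrix.star_apply,
      ContinuousLinearMap.star_eq_adjoint, ContinuousLinearMap.adjoint_inner_right,
      inner_self_eq_norm_sq_to_K] at h2
    exact h2
  have h3 : ∑ n, ‖V n j χ‖ ^ 2 = ‖χ‖ ^ 2 := by exact_mod_cast h1
  refine le_of_sq_le_sq ?_ (norm_nonneg _)
  rw [← h3]
  exact Finset.single_le_sum (f := fun n => ‖V n j χ‖ ^ 2) (fun n _ => sq_nonneg _)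
    (Finset.mem_univ i)

namespace Bath

variable {Ω : Type*} [MeasurableSpace Ω] {P : Measure Ω} [IsProbabilityMeasure P] {H : Type*}
  [NormedAddCommGroup H] [InnerProductSpace ℂ H] {ι : Type*} (b : Bath P H ι)

/-- The moments `⟨B(t₁) ⋯ B(tₙ) L(t)⟩` (with the list of times in reverse order). -/
def evolvedMoment (L : ℝ → JointOp (BathSpace P H)) (i j : Fin 2) (l : List ℝ) (t : ℝ) : ℂ :=
  ∑' k, (b.weight k : ℂ)
    * ⟪(opWord b.B l (b.vec k) : BathSpace P H), L t i j (b.vec k : BathSpace P H)⟫_ℂ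

variable [CompleteSpace H]

theorem norm_weight_mul_inner_le {V : JointOp (BathSpace P H)}
    (hV : V ∈ unitary (JointOp (BathSpace P H))) (i j : Fin 2) (l : List ℝ) (k : ι) :
    ‖(b.weight k : ℂ)
      * ⟪(opWord b.B l (b.vec k) : BathSpace P H), V i j (b.vec k : BathSpace P H)⟫_ℂ‖
      ≤ b.weight k * ‖(opWord b.B l (b.vec k) : BathSpace P H)‖ := by
  rw [norm_mul, norm_real, Real.norm_of_nonneg (b.weight_nonneg k)]
  refine mul_le_mul_of_nonneg_left ((norm_inner_le_norm _ _).trans ?_) (b.weight_nonneg k)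
  refine mul_le_of_le_one_right (norm_nonneg _) ?_
  exact (norm_unitary_entry_apply_le hV i j _).trans_eq (b.norm_vec k)

/-- The weak equation is tested against the word l applied to ψₖ, which lies in the domain because
the domain is invariant; the Hamiltonian then lengthens the word by one operator. Summation over k
commutes with the time integral because the Gaussian moment bound is uniform in time. -/
theorem evolvedMoment_eq (hgauss : b.IsGaussian) (hstat : b.IsStationary) {τ α : ℝ → ℝ} {a c : ℝ}
    {L : ℝ → JointOp (BathSpace P H)}
    (hL : IsWeakSolution b.dom (fun t => b.B (τ t)) (fun t => (α t : ℂ) • pauli Axis.z) a c L)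
    (hLu : ∀ t ∈ Set.Icc a c, L t ∈ unitary (JointOp (BathSpace P H))) (hL1 : L a = 1)
    (i j : Fin 2) {κ : ℝ → ℂ} (hκ : ∀ u, κ u = -I * ((α u : ℂ) * pauli Axis.z i i))
    (hκ1 : ∀ u, ‖κ u‖ ≤ 1) (l : List ℝ) {t : ℝ} (ht : t ∈ Set.Icc a c) :
    IntervalIntegrable (fun u => κ u * b.evolvedMoment L i j (τ u :: l) u) volume a t
    ∧ b.evolvedMoment L i j l t = (if i = j then b.moment l.reverse else 0)
      + ∫ u in a..t, κ u * b.evolvedMoment L i j (τ u :: l) u := by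
  have hac : a ≤ c := ht.1.trans ht.2
  have ha : a ∈ Set.Icc a c := ⟨le_rfl, hac⟩
  set R := max 1 ‖b.corr 0 0‖ with hR
  have hR1 : 1 ≤ R := le_max_left _ _
  have hCR : ‖b.corr 0 0‖ ≤ R := le_max_right _ _
  set f : ι → ℝ → ℂ := fun k u => κ u * ((b.weight k : ℂ)
    * ⟪(opWord b.B (τ u :: l) (b.vec k) : BathSpace P H), L u i j (b.vec k : BathSpace P H)⟫_ℂ)
    with hf
  -- As σ_z is diagonal, only n = i contributes to row i.
  have hterm : ∀ (k : ι) (u : ℝ), f k u = -I * (b.weight k : ℂ)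
      * ∑ n, ((α u : ℂ) • pauli Axis.z) i n
        * ⟪(b.B (τ u) (opWord b.B l (b.vec k)) : BathSpace P H),
            L u n j (b.vec k : BathSpace P H)⟫_ℂ := by
    intro k u
    have h0 : ∑ n, ((α u : ℂ) • pauli Axis.z) i n
        * ⟪(b.B (τ u) (opWord b.B l (b.vec k)) : BathSpace P H),
            L u n j (b.vec k : BathSpace P H)⟫_ℂ
        = ((α u : ℂ) * pauli Axis.z i i) * ⟪(b.B (τ u) (opWord b.B l (b.vec k)) : BathSpace P H),
            L u i j (b.vec k : BathSpace P H)⟫_ℂ := by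
      rw [Fin.sum_univ_two]
      fin_cases i <;> simp [pauli]
    rw [h0]
    simp only [hf, hκ, opWord]
    ring
  have hfnorm : ∀ u ∈ Set.Icc a c, ∀ k,
      ‖f k u‖ ≤ b.weight k * ‖(opWord b.B (τ u :: l) (b.vec k) : BathSpace P H)‖ := by
    intro u hu k
    rw [hf, norm_mul]
    exact (mul_le_of_le_one_left (norm_nonneg _) (hκ1 u)).trans
      (b.norm_weight_mul_inner_le (hLu u hu) i j (τ u :: l) k)
  have hint : ∀ k, IntervalIntegrable (f k) volume a t := by
    intro k
    have := (hL.integrable a ha t ht i j (opWord b.B l (b.vec k)) (b.vec k)).const_mul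
      (-I * (b.weight k : ℂ))
    simpa only [← hterm] using this
  obtain ⟨h1, h2⟩ := tsum_intervalIntegral_of_support (p := b.weight) b.weight_sum.summable
    (f := f) (M := (2 * R) ^ (l.length + 1) * √((l.length + 1).factorial))
    (fun k hk u => by simp [hf, hk]) ht.1 hint fun u hu => by
      have huc : u ∈ Set.Icc a c := ⟨hu.1.le, hu.2.trans ht.2⟩
      have hs := Summable.of_nonneg_of_le (fun k => norm_nonneg (f k u)) (hfnorm u huc)
        (b.summable_norm (τ u :: l))
      refine ⟨hs, (hs.tsum_le_tsum (hfnorm u huc) (b.summable_norm _)).trans ?_⟩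
      exact b.tsum_norm_le (by positivity) (b.tsum_sq_norm_le hgauss hstat hR1 hCR (τ u :: l))
  have hsum : ∀ u, ∑' k, f k u = κ u * b.evolvedMoment L i j (τ u :: l) u := fun u => by
    rw [evolvedMoment, ← tsum_mul_left]
  simp only [hsum] at h1 h2
  refine ⟨h1, ?_⟩
  have hsummable : ∀ V ∈ unitary (JointOp (BathSpace P H)), Summable fun k => (b.weight k : ℂ)
      * ⟪(opWord b.B l (b.vec k) : BathSpace P H), V i j (b.vec k : BathSpace P H)⟫_ℂ :=
    fun V hV => Summable.of_norm_bounded (b.summable_norm l)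
      fun k => b.norm_weight_mul_inner_le hV i j l k
  have hinit : (if i = j then b.moment l.reverse else 0) = ∑' k, (b.weight k : ℂ)
      * ⟪(opWord b.B l (b.vec k) : BathSpace P H),
          (1 : JointOp (BathSpace P H)) i j (b.vec k : BathSpace P H)⟫_ℂ := by
    simp only [one_jointOp_apply]
    split_ifs
    · rw [moment_reverse]
    · simp
  rw [← h2, hinit, ← sub_eq_iff_eq_add', evolvedMoment,
    ← (hsummable _ (hLu t ht)).tsum_sub (hsummable 1 (one_mem _))]
  refine tsum_congr fun k => ?_
  have heq := hL.eq a ha t ht i j (opWord b.B l (b.vec k)) (b.vec k)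
  rw [heq, hL1]
  simp only [hterm]
  rw [intervalIntegral.integral_const_mul]
  ring

theorem norm_evolvedMoment_le (hgauss : b.IsGaussian) (hstat : b.IsStationary) {R : ℝ}
    (hR : 1 ≤ R) (hCR : ‖b.corr 0 0‖ ≤ R) {L : ℝ → JointOp (BathSpace P H)} {t : ℝ}
    (hLu : L t ∈ unitary (JointOp (BathSpace P H))) (i j : Fin 2) (l : List ℝ) :
    ‖b.evolvedMoment L i j l t‖ ≤ (2 * R) ^ l.length * √(l.length.factorial) :=
  (tsum_of_norm_bounded (b.summable_norm l).hasSum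
    fun k => b.norm_weight_mul_inner_le hLu i j l k).trans
    (b.tsum_norm_le (by positivity) (b.tsum_sq_norm_le hgauss hstat hR hCR l))

/-- The expectation of a Gaussian dephasing evolution: the second-order cumulant expansion is
exact. -/
theorem reduce_eq_exp (hgauss : b.IsGaussian) (hstat : b.IsStationary)
    (hcont : Continuous fun τ : ℝ => b.corr τ 0) {τ α : ℝ → ℝ} {a c : ℝ} (hac : a ≤ c)
    {L : ℝ → JointOp (BathSpace P H)} (hτ : Continuous τ) (hα : ∀ u, |α u| ≤ 1)
    (hαm : Measurable α) {S : Set ℝ} (hS : S.Countable) (hαc : ∀ u, u ∉ S → ContinuousAt α u)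
    (hL : IsWeakSolution b.dom (fun t => b.B (τ t)) (fun t => (α t : ℂ) • pauli Axis.z) a c L)
    (hLu : ∀ t ∈ Set.Icc a c, L t ∈ unitary (JointOp (BathSpace P H))) (hL1 : L a = 1) :
    b.reduce (L c)
      = exp (-∫ t in a..c, ∫ u in a..t, (α t : ℂ) * (α u : ℂ) * b.corr (τ t) (τ u)) • 1 := by
  ext i j
  have hs : pauli Axis.z i i * pauli Axis.z i i = 1 := by fin_cases i <;> simp [pauli]
  have hs1 : ‖pauli Axis.z i i‖ = 1 := by fin_cases i <;> simp [pauli]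
  set κ : ℝ → ℂ := fun u => -I * ((α u : ℂ) * pauli Axis.z i i) with hκ
  have hκ1 : ∀ u, ‖κ u‖ ≤ 1 := fun u => by
    simp only [hκ, norm_mul, norm_neg, norm_I, hs1, norm_real, one_mul, mul_one]
    exact hα u
  have hκm : Measurable κ := by fun_prop
  have hκc : ∀ u, u ∉ S → ContinuousAt κ u := fun u hu =>
    continuousAt_const.mul ((continuous_ofReal.continuousAt.comp (hαc u hu)).mul
      continuousAt_const)
  have hcC : c ∈ Set.Icc a c := ⟨hac, le_rfl⟩
  have hC := b.norm_corr_le hstat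
  have hCc := b.continuous_corr hstat hcont
  set C := ‖b.corr 0 0‖ with hCdef
  have hC0 : 0 ≤ C := norm_nonneg _
  -- The summand C (c - a) bounds the drift mean and C the two-point function, as
  -- `norm_wickShift_le` requires.
  set R := max 1 (C * (c - a) + C) with hR
  have hR1 : 1 ≤ R := le_max_left _ _
  have hRC : C * (c - a) + C ≤ R := le_max_right _ _
  have hCR : C ≤ R := le_trans (by nlinarith [mul_nonneg hC0 (sub_nonneg.2 hac)]) hRC
  have hF := fun l t ht => b.evolvedMoment_eq hgauss hstat hL hLu hL1 i j (κ := κ)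
    (fun _ => rfl) hκ1 l (t := t) ht
  have hFb := fun l t ht => b.norm_evolvedMoment_le hgauss hstat hR1 hCR (hLu t ht) i j l
  have hred : b.reduce (L c) i j = b.evolvedMoment L i j [] c := rfl
  rw [hred, Matrix.smul_apply, Matrix.one_apply]
  split_ifs with hij
  · have hG := fun l t => gaussianFlow_eq (a := a) hCc hC hτ hκm hκ1 hS hκc l t
    -- The evolved moments and the Gaussian flow satisfy the same equation with the same Wick
    -- moments as initial values, so their difference solves the homogeneous hierarchy.
    have hzero := hierarchy_eq_zero (τ := τ) (κ := κ) (a := a) (c := c) (R := 2 * R)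
      (M := 1 + Real.exp (C * (c - a) * (c - a)))
      (D := fun l t => b.evolvedMoment L i j l t - gaussianFlow b.corr τ κ a l t) hκ1
      (fun l t ht => ?_) (fun l t ht => ?_) hcC (by positivity)
    · rw [sub_eq_zero.1 hzero, gaussianFlow, List.reverse_nil, wickShift_nil, mul_one, smul_eq_mul,
        mul_one, gaussianExponent, ← intervalIntegral.integral_neg]
      congr 1
      refine intervalIntegral.integral_congr fun t _ => ?_
      simp only [driftMean]
      rw [← intervalIntegral.integral_const_mul, ← intervalIntegral.integral_neg]
      refine intervalIntegral.integral_congr fun u _ => ?_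
      simp only [hκ]
      -- The product of two couplings κ contains (-i)² = -1 and the square of an eigenvalue of σ_z,
      -- which is 1; hence both rows give the same exponent.
      linear_combination ((α t : ℂ) * (α u : ℂ) * b.corr (τ t) (τ u))
        * (I * I * hs + I_mul_I)
    · refine (norm_sub_le _ _).trans ?_
      rw [add_mul, one_mul]
      refine add_le_add (hFb l t ht) ((norm_gaussianFlow_le hC hκ1 hR1 hRC l ht).trans ?_)
      gcongr
      linarith
    · have h1 := hF l t ht
      have h2 := hG l t
      simp only [mul_sub]
      rw [intervalIntegral.integral_sub h1.1 h2.1, h1.2, h2.2, if_pos hij, hgauss]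
      ring
  · have hzero := hierarchy_eq_zero (τ := τ) (κ := κ) (a := a) (c := c) (R := 2 * R) (M := 1)
      (D := b.evolvedMoment L i j) hκ1 (fun l t ht => by rw [one_mul]; exact hFb l t ht)
      (fun l t ht => by rw [(hF l t ht).2, if_neg hij, zero_add]) hcC (by positivity)
    rw [hzero, smul_zero]

end Bath

/-! ### Folding the integral over `[-T, T]` onto `[0, T]` -/

theorem integral_interval_swap {K : ℝ → ℝ → ℂ} {T M : ℝ} (hT : 0 ≤ T)
    (hK : Measurable (Function.uncurry K)) (hM : ∀ x y, ‖K x y‖ ≤ M) :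
    ∫ t in (0 : ℝ)..T, ∫ u in (0 : ℝ)..T, K t u = ∫ u in (0 : ℝ)..T, ∫ t in (0 : ℝ)..T, K t u := by
  simp only [intervalIntegral.integral_of_le hT]
  exact integral_integral_swap
    ((integrable_const M).mono' hK.aestronglyMeasurable (ae_of_all _ fun p => hM p.1 p.2))

/-- Fubini on the square, after extending the integrand by zero outside the triangle u ≤ t. -/
theorem integral_triangle_swap {K : ℝ → ℝ → ℂ} {T M : ℝ} (hT : 0 ≤ T)
    (hK : Measurable (Function.uncurry K)) (hM : ∀ x y, ‖K x y‖ ≤ M) :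
    ∫ t in (0 : ℝ)..T, ∫ u in (0 : ℝ)..t, K t u = ∫ u in (0 : ℝ)..T, ∫ t in u..T, K t u := by
  have hM0 : 0 ≤ M := (norm_nonneg _).trans (hM 0 0)
  have hswap := integral_interval_swap (K := fun t u => if u ≤ t then K t u else 0) hT
    (Measurable.ite (measurableSet_le measurable_snd measurable_fst) hK measurable_const)
    (M := M) fun x y => by
      split_ifs
      · exact hM x y
      · simpa using hM0
  have h1 : ∫ t in (0 : ℝ)..T, ∫ u in (0 : ℝ)..t, K t u
      = ∫ t in (0 : ℝ)..T, ∫ u in (0 : ℝ)..T, if u ≤ t then K t u else 0 := by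
    refine intervalIntegral.integral_congr fun t ht => ?_
    rw [Set.uIcc_of_le hT] at ht
    rw [intervalIntegral.integral_of_le hT, intervalIntegral.integral_of_le ht.1]
    have h := setIntegral_indicator (μ := volume) (s := Set.Ioc 0 T) (f := K t)
      (measurableSet_Iic (a := t))
    have hs : Set.Ioc 0 T ∩ Set.Iic t = Set.Ioc 0 t := by
      ext u
      simp only [Set.mem_inter_iff, Set.mem_Ioc, Set.mem_Iic]
      exact ⟨fun h => ⟨h.1.1, h.2⟩, fun h => ⟨⟨h.1, h.2.trans ht.2⟩, h.2⟩⟩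
    rw [hs] at h
    rw [← h]
    rfl
  have h2 : ∫ u in (0 : ℝ)..T, ∫ t in u..T, K t u
      = ∫ u in (0 : ℝ)..T, ∫ t in (0 : ℝ)..T, if u ≤ t then K t u else 0 := by
    refine intervalIntegral.integral_congr_ae (ae_of_all _ fun u hu => ?_)
    rw [Set.uIoc_of_le hT] at hu
    rw [intervalIntegral.integral_of_le hT, intervalIntegral.integral_of_le hu.2]
    have h := setIntegral_indicator (μ := volume) (s := Set.Ioc 0 T) (f := fun t => K t u)
      (measurableSet_Ici (a := u))
    have hs : Set.Ioc 0 T ∩ Set.Ici u = Set.Icc u T := by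
      ext t
      simp only [Set.mem_inter_iff, Set.mem_Ioc, Set.mem_Ici, Set.mem_Icc]
      exact ⟨fun h => ⟨h.2, h.1.2⟩, fun h => ⟨⟨hu.1.trans_le h.1, h.2⟩, h.1⟩⟩
    rw [hs, integral_Icc_eq_integral_Ioc] at h
    rw [← h]
    rfl
  rw [h1, hswap, h2]

theorem effTime_eq (T t : ℝ) : effTime T t = T - |t| := by
  rw [effTime]
  split_ifs with h
  · rw [abs_of_pos h]
  · rw [abs_of_nonpos (not_lt.1 h), sub_neg_eq_add]

theorem continuous_effTime (T : ℝ) : Continuous (effTime T) := by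
  rw [show effTime T = fun t => T - |t| from funext (effTime_eq T)]
  fun_prop

section Fold

variable {c : ℝ → ℝ → ℂ} {C T : ℝ}

theorem continuous_apply_left (hc : Continuous (Function.uncurry c)) (x : ℝ) : Continuous (c x) :=
  hc.comp (continuous_const.prodMk continuous_id)

theorem integral_mul_integral_swap (hc : Continuous (Function.uncurry c))
    (hC : ∀ x y, ‖c x y‖ ≤ C) (hT : 0 ≤ T) {f g : ℝ → ℂ} (hfm : Measurable f)
    (hf : ∀ u, ‖f u‖ ≤ 1) (hgm : Measurable g) (hg : ∀ u, ‖g u‖ ≤ 1) :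
    ∫ t in (0 : ℝ)..T, ∫ u in (0 : ℝ)..T, g t * f u * c u t
      = ∫ u in (0 : ℝ)..T, f u * driftMean c id g 0 T u := by
  have hC0 : 0 ≤ C := (norm_nonneg _).trans (hC 0 0)
  rw [integral_interval_swap (M := C) hT]
  · refine intervalIntegral.integral_congr fun u _ => ?_
    simp only [driftMean, id]
    rw [← intervalIntegral.integral_const_mul]
    exact intervalIntegral.integral_congr fun t _ => by ring
  · exact ((hgm.comp measurable_fst).mul (hfm.comp measurable_snd)).mul
      (hc.measurable.comp measurable_swap)
  · intro x y
    rw [norm_mul, norm_mul]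
    exact (mul_le_of_le_one_left (norm_nonneg _)
      (mul_le_one₀ (hg x) (norm_nonneg _) (hf y))).trans (hC _ _)

theorem driftMean_sub_driftMean (hc : Continuous (Function.uncurry c)) {g : ℝ → ℂ}
    (hgm : Measurable g) (hg : ∀ u, ‖g u‖ ≤ 1) (s t x : ℝ) :
    driftMean c id g 0 t x - driftMean c id g 0 s x = ∫ u in s..t, g u * c x u := by
  have hint : ∀ s t, IntervalIntegrable (fun u => g u * c x u) volume s t := fun s t =>
    (intervalIntegrable_of_measurable_of_norm_le hgm hg s t).mul_continuousOn
      (continuous_apply_left hc x).continuousOn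
  exact intervalIntegral.integral_interval_sub_left (hint 0 t) (hint 0 s)

theorem integral_mul_integral_triangle_swap (hc : Continuous (Function.uncurry c))
    (hC : ∀ x y, ‖c x y‖ ≤ C) (hT : 0 ≤ T) {f g : ℝ → ℂ} (hfm : Measurable f)
    (hf : ∀ u, ‖f u‖ ≤ 1) (hgm : Measurable g) (hg : ∀ u, ‖g u‖ ≤ 1) :
    ∫ t in (0 : ℝ)..T, ∫ u in (0 : ℝ)..t, g t * f u * c u t
      = ∫ u in (0 : ℝ)..T, f u * (driftMean c id g 0 T u - driftMean c id g 0 u u) := by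
  rw [integral_triangle_swap (M := C) hT]
  · refine intervalIntegral.integral_congr fun u _ => ?_
    rw [driftMean_sub_driftMean hc hgm hg, ← intervalIntegral.integral_const_mul]
    exact intervalIntegral.integral_congr fun t _ => by ring
  · exact ((hgm.comp measurable_fst).mul (hfm.comp measurable_snd)).mul
      (hc.measurable.comp measurable_swap)
  · intro x y
    rw [norm_mul, norm_mul]
    exact (mul_le_of_le_one_left (norm_nonneg _)
      (mul_le_one₀ (hg x) (norm_nonneg _) (hf y))).trans (hC _ _)

theorem driftMean_add (hc : Continuous (Function.uncurry c)) {f g : ℝ → ℂ}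
    (hfm : Measurable f) (hf : ∀ u, ‖f u‖ ≤ 1) (hgm : Measurable g) (hg : ∀ u, ‖g u‖ ≤ 1)
    (t x : ℝ) : driftMean c id (fun u => f u + g u) 0 t x
      = driftMean c id f 0 t x + driftMean c id g 0 t x := by
  simp only [driftMean, add_mul]
  exact intervalIntegral.integral_add
    ((intervalIntegrable_of_measurable_of_norm_le hfm hf 0 t).mul_continuousOn
      (continuous_apply_left hc x).continuousOn)
    ((intervalIntegrable_of_measurable_of_norm_le hgm hg 0 t).mul_continuousOn
      (continuous_apply_left hc x).continuousOn)

/-- The double integral over `-T ≤ u ≤ t ≤ T` of a Hamiltonian with coupling `p (T + t)` for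
`t ≤ 0` and `- q (T - t)` for `t > 0`. -/
theorem integral_effTime_eq (hc : Continuous (Function.uncurry c)) (hC : ∀ x y, ‖c x y‖ ≤ C)
    (hT : 0 ≤ T) {p q α : ℝ → ℂ} (hpm : Measurable p) (hp : ∀ u, ‖p u‖ ≤ 1) (hqm : Measurable q)
    (hq : ∀ u, ‖q u‖ ≤ 1) (hα : ∀ t, α t = if 0 < t then -q (T - t) else p (T + t)) :
    ∫ t in (-T)..T, ∫ u in (-T)..t, α t * α u * c (effTime T t) (effTime T u)
      = (∫ s in (0 : ℝ)..T, p s * driftMean c id p 0 s s)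
        - ∫ s in (0 : ℝ)..T, q s * (driftMean c id p 0 T s - driftMean c id q 0 T s
            + driftMean c id q 0 s s) := by
  have hαm : Measurable α := by
    rw [show α = fun t => if 0 < t then -q (T - t) else p (T + t) from funext hα]
    exact Measurable.ite measurableSet_Ioi (by fun_prop) (by fun_prop)
  have hα1 : ∀ t, ‖α t‖ ≤ 1 := fun t => by
    rw [hα]
    split_ifs
    · rw [norm_neg]; exact hq _
    · exact hp _
  have hτ := continuous_effTime T
  set E : ℝ → ℝ → ℂ := fun t x => driftMean c (effTime T) α (-T) t x with hE
  have hEc : Continuous fun t => E t (effTime T t) :=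
    (continuous_driftMean hc hC hτ hαm hα1).comp (hτ.prodMk continuous_id)
  have hαE : ∀ s t, IntervalIntegrable (fun t => α t * E t (effTime T t)) volume s t := fun s t =>
    (intervalIntegrable_of_measurable_of_norm_le hαm hα1 s t).mul_continuousOn hEc.continuousOn
  have hαc : ∀ x s t, IntervalIntegrable (fun u => α u * c x (effTime T u)) volume s t :=
    fun x s t => (intervalIntegrable_of_measurable_of_norm_le hαm hα1 s t).mul_continuousOn
      ((continuous_apply_left hc x).comp hτ).continuousOn
  have hΓ : ∫ t in (-T)..T, ∫ u in (-T)..t, α t * α u * c (effTime T t) (effTime T u)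
      = ∫ t in (-T)..T, α t * E t (effTime T t) := by
    refine intervalIntegral.integral_congr fun t _ => ?_
    simp only [hE, driftMean]
    rw [← intervalIntegral.integral_const_mul]
    exact intervalIntegral.integral_congr fun u _ => by ring
  have hneg : ∀ x, ∀ t ≤ 0, -T ≤ t → E t x = driftMean c id p 0 (T + t) x := by
    intro x t ht ht'
    have h1 : E t x = ∫ u in (-T)..t, p (T + u) * c x (T + u) := by
      refine intervalIntegral.integral_congr_ae (ae_of_all _ fun u hu => ?_)
      rw [Set.uIoc_of_le ht'] at hu
      have hu0 : ¬ 0 < u := not_lt.2 (hu.2.trans ht)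
      rw [hα, effTime, if_neg hu0, if_neg hu0]
    rw [h1, intervalIntegral.integral_comp_add_left (fun u => p u * c x u), add_neg_cancel]
    rfl
  -- Past the fold, the accumulated mean consists of the whole forward branch and of the stretch of
  -- the backward branch between the physical times T and T - t.
  have hpos : ∀ x, ∀ t, 0 ≤ t → E t x = driftMean c id p 0 T x - driftMean c id q 0 T x
      + driftMean c id q 0 (T - t) x := by
    intro x t ht
    have h1 : E t x = E 0 x + ∫ u in (0 : ℝ)..t, α u * c x (effTime T u) :=
      (intervalIntegral.integral_add_adjacent_intervals (hαc x _ _) (hαc x _ _)).symm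
    have h2 : ∫ u in (0 : ℝ)..t, α u * c x (effTime T u)
        = ∫ u in (0 : ℝ)..t, -(q (T - u) * c x (T - u)) := by
      refine intervalIntegral.integral_congr_ae (ae_of_all _ fun u hu => ?_)
      rw [Set.uIoc_of_le ht] at hu
      rw [hα, effTime, if_pos hu.1, if_pos hu.1, neg_mul]
    rw [h1, h2, hneg x 0 le_rfl (by linarith), add_zero, intervalIntegral.integral_neg,
      intervalIntegral.integral_comp_sub_left (fun u => q u * c x u), sub_zero,
      ← driftMean_sub_driftMean hc hqm hq]
    ring
  rw [hΓ, ← intervalIntegral.integral_add_adjacent_intervals (hαE (-T) 0) (hαE 0 T), sub_eq_add_neg]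
  congr 1
  · have h1 : ∫ t in (-T)..0, α t * E t (effTime T t)
        = ∫ t in (-T)..0, p (T + t) * driftMean c id p 0 (T + t) (T + t) := by
      refine intervalIntegral.integral_congr_ae (ae_of_all _ fun t ht => ?_)
      rw [Set.uIoc_of_le (by linarith)] at ht
      have h0 : ¬ 0 < t := not_lt.2 ht.2
      rw [hα, effTime, if_neg h0, if_neg h0, hneg _ t ht.2 ht.1.le]
    rw [h1, intervalIntegral.integral_comp_add_left (fun s => p s * driftMean c id p 0 s s),
      add_neg_cancel, add_zero]
  · have h1 : ∫ t in (0 : ℝ)..T, α t * E t (effTime T t)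
        = ∫ t in (0 : ℝ)..T, -(q (T - t) * (driftMean c id p 0 T (T - t)
            - driftMean c id q 0 T (T - t) + driftMean c id q 0 (T - t) (T - t))) := by
      refine intervalIntegral.integral_congr_ae (ae_of_all _ fun t ht => ?_)
      rw [Set.uIoc_of_le hT] at ht
      rw [hα, effTime, if_pos ht.1, if_pos ht.1, hpos _ t ht.1.le, neg_mul]
    rw [h1, intervalIntegral.integral_neg, intervalIntegral.integral_comp_sub_left (fun s => q s *
      (driftMean c id p 0 T s - driftMean c id q 0 T s + driftMean c id q 0 s s)), sub_self,
      sub_zero]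

/-- The folded double integral in terms of the sum and the difference of the couplings of the two
branches. -/
theorem integral_effTime_eq_add (hc : Continuous (Function.uncurry c)) (hC : ∀ x y, ‖c x y‖ ≤ C)
    (hT : 0 ≤ T) {p q w m α : ℝ → ℂ} (hpm : Measurable p) (hp : ∀ u, ‖p u‖ ≤ 1)
    (hqm : Measurable q) (hq : ∀ u, ‖q u‖ ≤ 1) (hwm : Measurable w) (hw : ∀ u, ‖w u‖ ≤ 1)
    (hmm : Measurable m) (hm : ∀ u, ‖m u‖ ≤ 1) (hpw : ∀ u, p u = w u + m u)
    (hqw : ∀ u, q u = w u + -m u) (hα : ∀ t, α t = if 0 < t then -q (T - t) else p (T + t)) :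
    ∫ t in (-T)..T, ∫ u in (-T)..t, α t * α u * c (effTime T t) (effTime T u)
      = (∫ t in (0 : ℝ)..T, ∫ u in (0 : ℝ)..T, m t * m u * (c t u + c u t))
        + 2 * ∫ t in (0 : ℝ)..T, ∫ u in (0 : ℝ)..t, m t * w u * (c t u - c u t) := by
  have hcr : ∀ t, Continuous fun u => c u t := fun t =>
    hc.comp (continuous_id.prodMk continuous_const)
  have hnm : Measurable fun u => -m u := hmm.neg
  have hn : ∀ u, ‖-m u‖ ≤ 1 := fun u => by rw [norm_neg]; exact hm u
  have hcont : ∀ {f : ℝ → ℂ}, Measurable f → (∀ u, ‖f u‖ ≤ 1) →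
      (Continuous fun s => driftMean c id f 0 T s) ∧ Continuous fun s => driftMean c id f 0 s s :=
    fun hfm hf => ⟨(continuous_driftMean hc hC continuous_id hfm hf).comp
      (continuous_id.prodMk continuous_const),
      (continuous_driftMean hc hC continuous_id hfm hf).comp (continuous_id.prodMk continuous_id)⟩
  have hint : ∀ {f g : ℝ → ℂ}, Measurable f → (∀ u, ‖f u‖ ≤ 1) → Continuous g →
      IntervalIntegrable (fun s => f s * g s) volume 0 T := fun hfm hf hg =>
    (intervalIntegrable_of_measurable_of_norm_le hfm hf 0 T).mul_continuousOn hg.continuousOn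
  have hfc : ∀ {f g : ℝ → ℂ}, Measurable f → (∀ u, ‖f u‖ ≤ 1) → Continuous g → ∀ s t,
      IntervalIntegrable (fun u => f u * g u) volume s t := fun hfm hf hg s t =>
    (intervalIntegrable_of_measurable_of_norm_le hfm hf s t).mul_continuousOn hg.continuousOn
  have hmd : IntervalIntegrable
      (fun s => w s * (driftMean c id m 0 T s - driftMean c id m 0 s s)) volume 0 T :=
    hint hwm hw ((hcont hmm hm).1.sub (hcont hmm hm).2)
  have hmw : IntervalIntegrable (fun s => 2 * (m s * driftMean c id w 0 s s
      - w s * (driftMean c id m 0 T s - driftMean c id m 0 s s))) volume 0 T :=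
    ((hint hmm hm (hcont hwm hw).2).sub hmd).const_mul 2
  have hpq : IntervalIntegrable (fun s => q s * (driftMean c id p 0 T s - driftMean c id q 0 T s
      + driftMean c id q 0 s s)) volume 0 T :=
    hint hqm hq (((hcont hpm hp).1.sub (hcont hqm hq).1).add (hcont hqm hq).2)
  -- the symmetric part
  have hplus : ∫ t in (0 : ℝ)..T, ∫ u in (0 : ℝ)..T, m t * m u * (c t u + c u t)
      = ∫ s in (0 : ℝ)..T, 2 * (m s * driftMean c id m 0 T s) := by
    have h1 : ∀ t, ∫ u in (0 : ℝ)..T, m t * m u * (c t u + c u t)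
        = m t * driftMean c id m 0 T t + m t * ∫ u in (0 : ℝ)..T, m u * c u t := by
      intro t
      simp only [driftMean, id]
      rw [← mul_add, ← intervalIntegral.integral_add
        (hfc hmm hm (continuous_apply_left hc t) 0 T) (hfc hmm hm (hcr t) 0 T),
        ← intervalIntegral.integral_const_mul]
      exact intervalIntegral.integral_congr fun u _ => by ring
    have h2 := integral_mul_integral_swap hc hC hT hmm hm hmm hm
    have h3 : ∀ t, ∫ u in (0 : ℝ)..T, m t * m u * c u t
        = m t * ∫ u in (0 : ℝ)..T, m u * c u t := fun t => by
      simp only [mul_assoc, intervalIntegral.integral_const_mul]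
    have hi : IntervalIntegrable (fun t => m t * ∫ u in (0 : ℝ)..T, m u * c u t) volume 0 T := by
      refine hint hmm hm ?_
      exact (continuous_driftMean (c := fun x y => c y x) (a := 0) (hc.comp continuous_swap)
        (fun x y => hC y x) continuous_id hmm hm).comp (continuous_id.prodMk continuous_const)
    simp only [h3] at h2
    simp only [h1]
    rw [intervalIntegral.integral_add (hint hmm hm (hcont hmm hm).1) hi, h2,
      intervalIntegral.integral_const_mul]
    ring
  -- the antisymmetric part
  have hminus : ∫ t in (0 : ℝ)..T, ∫ u in (0 : ℝ)..t, m t * w u * (c t u - c u t)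
      = ∫ s in (0 : ℝ)..T, (m s * driftMean c id w 0 s s
          - w s * (driftMean c id m 0 T s - driftMean c id m 0 s s)) := by
    have h1 : ∀ t, ∫ u in (0 : ℝ)..t, m t * w u * (c t u - c u t)
        = m t * driftMean c id w 0 t t - m t * ∫ u in (0 : ℝ)..t, w u * c u t := by
      intro t
      simp only [driftMean, id]
      rw [← mul_sub, ← intervalIntegral.integral_sub
        (hfc hwm hw (continuous_apply_left hc t) 0 t) (hfc hwm hw (hcr t) 0 t),
        ← intervalIntegral.integral_const_mul]
      exact intervalIntegral.integral_congr fun u _ => by ring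
    have h2 := integral_mul_integral_triangle_swap hc hC hT hwm hw hmm hm
    have h3 : ∀ t, ∫ u in (0 : ℝ)..t, m t * w u * c u t
        = m t * ∫ u in (0 : ℝ)..t, w u * c u t := fun t => by
      simp only [mul_assoc, intervalIntegral.integral_const_mul]
    have hi : IntervalIntegrable (fun t => m t * ∫ u in (0 : ℝ)..t, w u * c u t) volume 0 T := by
      refine hint hmm hm ?_
      exact (continuous_driftMean (c := fun x y => c y x) (a := 0) (hc.comp continuous_swap)
        (fun x y => hC y x) continuous_id hwm hw).comp (continuous_id.prodMk continuous_id)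
    simp only [h3] at h2
    simp only [h1]
    rw [intervalIntegral.integral_sub (hint hmm hm (hcont hwm hw).2) hi, h2,
      intervalIntegral.integral_sub (hint hmm hm (hcont hwm hw).2) hmd]
  have hpd : ∀ t x, driftMean c id p 0 t x = driftMean c id w 0 t x + driftMean c id m 0 t x := by
    intro t x
    rw [← driftMean_add hc hwm hw hmm hm, show p = fun u => w u + m u from funext hpw]
  have hqd : ∀ t x, driftMean c id q 0 t x = driftMean c id w 0 t x - driftMean c id m 0 t x := by
    intro t x
    rw [show q = fun u => w u + -m u from funext hqw, driftMean_add hc hwm hw hnm hn, sub_eq_add_neg]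
    congr 1
    simp [driftMean]
  rw [integral_effTime_eq hc hC hT hpm hp hqm hq hα, hplus, hminus,
    ← intervalIntegral.integral_const_mul, ← intervalIntegral.integral_sub
      (hint hpm hp (hcont hpm hp).2) hpq,
    ← intervalIntegral.integral_add ((hint hmm hm (hcont hmm hm).1).const_mul 2) hmw]
  -- Both sides are now single integrals of drift means, so with p = w + m and q = w - m the
  -- identity holds pointwise in s.
  refine intervalIntegral.integral_congr fun s _ => ?_
  simp only [hpd, hqd, hpw, hqw]
  ring

end Fold

/-! ### Switching functions -/

section Switching

/-- Displays a switching sign as a finite product of step functions, for which measurability and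
continuity away from the jumps are elementary. -/
theorem prod_ite_eq_neg_one_pow {β : Type*} (s : Finset β) (Q : β → Prop) [DecidablePred Q]
    (n : β → ℕ) : ((-1 : ℝ)) ^ (∑ j ∈ s.filter Q, n j) = ∏ j ∈ s, if Q j then (-1) ^ n j else 1 := by
  rw [← Finset.prod_pow_eq_pow_sum, Finset.prod_filter]

theorem measurable_switching (Q : Finset ℝ) : Measurable (switching Q) := by
  have h : switching Q = fun t => ∏ j ∈ Q, if j ≤ t then (-1 : ℝ) ^ 1 else 1 := by
    ext t
    rw [← prod_ite_eq_neg_one_pow, Finset.sum_const, smul_eq_mul, mul_one, switching]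
  rw [h]
  exact Finset.measurable_prod _ fun j _ =>
    Measurable.ite measurableSet_Ici measurable_const measurable_const

theorem continuousAt_ite_of_eventually {X Y : Type*} [TopologicalSpace X] [TopologicalSpace Y]
    {Q : X → Prop} [DecidablePred Q] {t : X} (x y : Y)
    (h : (∀ᶠ s in nhds t, Q s) ∨ ∀ᶠ s in nhds t, ¬ Q s) :
    ContinuousAt (fun s => if Q s then x else y) t := by
  rcases h with h | h
  · exact (continuousAt_const (y := x)).congr (h.mono fun s hs => by simp [hs])
  · exact (continuousAt_const (y := y)).congr (h.mono fun s hs => by simp [hs])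

theorem continuousAt_switching (Q : Finset ℝ) {t : ℝ} (ht : t ∉ Q) :
    ContinuousAt (switching Q) t := by
  have h : switching Q = fun t => ∏ j ∈ Q, if j ≤ t then (-1 : ℝ) ^ 1 else 1 := by
    ext t
    rw [← prod_ite_eq_neg_one_pow, Finset.sum_const, smul_eq_mul, mul_one, switching]
  rw [h]
  refine tendsto_finsetProd _ fun j hj => continuousAt_ite_of_eventually _ _ ?_
  rcases lt_trichotomy j t with hjt | rfl | hjt
  · exact Or.inl ((lt_mem_nhds hjt).mono fun s hs => hs.le)
  · exact absurd hj ht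
  · exact Or.inr ((gt_mem_nhds hjt).mono fun s hs => not_le.2 hs)

variable {N : ℕ} (tp : Fin (N + 1) → ℝ) {y : ℝ → ℝ} (r : Fin (N + 1) → Fin 2)

theorem measurable_branchSwitching (hy : Measurable y) : Measurable (branchSwitching tp y r) := by
  unfold branchSwitching
  simp only [prod_ite_eq_neg_one_pow]
  refine (Finset.measurable_prod _ fun j _ => ?_).mul hy
  refine Measurable.ite ?_ measurable_const measurable_const
  exact measurableSet_Iio.union (MeasurableSet.const _)

theorem continuousAt_branchSwitching {t : ℝ} (hy : ContinuousAt y t) (ht : t ∉ Set.range tp) :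
    ContinuousAt (branchSwitching tp y r) t := by
  unfold branchSwitching
  simp only [prod_ite_eq_neg_one_pow]
  refine ContinuousAt.mul (tendsto_finsetProd _ fun j _ =>
    continuousAt_ite_of_eventually _ _ ?_) hy
  by_cases hj : j = Fin.last N
  · exact Or.inl (Filter.Eventually.of_forall fun s => Or.inr hj)
  rcases lt_trichotomy t (tp j) with h | h | h
  · exact Or.inl ((gt_mem_nhds h).mono fun s hs => Or.inl hs)
  · exact absurd ⟨j, h.symm⟩ ht
  · exact Or.inr ((lt_mem_nhds h).mono fun s hs => by simp [hj, hs.le])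

theorem abs_switching (Q : Finset ℝ) (t : ℝ) : |switching Q t| = 1 := by
  rw [switching, abs_pow]
  simp

theorem abs_branchSwitching {t : ℝ} (hy : |y t| = 1) : |branchSwitching tp y r t| = 1 := by
  rw [branchSwitching, abs_mul, abs_pow, hy]
  simp

/-- Inside the interval the rotations still to come are exactly those of index at least `k.succ`.
The last one is always among them, so the extra clause in `branchSwitching`, which serves t = T,
changes nothing here. -/
theorem branchSwitching_of_mem_Ioo {tp : Fin (N + 1) → ℝ} (htp : StrictMono tp) (k : Fin N) {t : ℝ}
    (ht : t ∈ Set.Ioo (tp k.castSucc) (tp k.succ)) :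
    branchSwitching tp y r t = (((-1) ^ tailWeight r k.succ : ℤˣ) : ℤ) * y t := by
  have h : ∀ j : Fin (N + 1), (t < tp j ∨ j = Fin.last N) ↔ k.succ ≤ j := by
    intro j
    constructor
    · rintro (h | rfl)
      · by_contra hj
        have : j ≤ k.castSucc := Fin.le_castSucc_iff.2 (not_le.1 hj)
        exact absurd (h.trans_le (htp.monotone this)) (not_lt.2 ht.1.le)
      · exact Fin.le_last _
    · exact fun h => Or.inl (ht.2.trans_le (htp.monotone h))
  simp only [branchSwitching, tailWeight, h]
  push_cast
  rfl

/-- The coupling of the effective Hamiltonian on `[-T, T]`, without the factor `σ_z`. -/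
def effSign {N : ℕ} (tp : Fin (N + 1) → ℝ) (y : ℝ → ℝ) (o : Axis) (r r' : Fin (N + 1) → Fin 2)
    (T t : ℝ) : ℝ :=
  if 0 < t then -(pauliSign o Axis.z * branchSwitching tp y r' (T - t))
  else branchSwitching tp y r (T + t)

variable (o : Axis) (r' : Fin (N + 1) → Fin 2) (T : ℝ)

theorem effCoupling_eq (t : ℝ) :
    effCoupling tp y o r r' T t = (effSign tp y o r r' T t : ℂ) • pauli Axis.z := by
  rw [effCoupling, effSign]
  split_ifs
  · rw [pauli_conj, smul_smul]
    push_cast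
    congr 1
    ring
  · rfl

theorem abs_pauliSign_mul (α : Axis) (x : ℝ) : |pauliSign o α * x| = |x| := by
  rcases pauliSign_eq o α with h | h <;> simp [h]

theorem abs_effSign (hy : ∀ t, |y t| = 1) (t : ℝ) : |effSign tp y o r r' T t| = 1 := by
  rw [effSign]
  split_ifs
  · rw [abs_neg, abs_pauliSign_mul, abs_branchSwitching tp r' (hy _)]
  · exact abs_branchSwitching tp r (hy _)

theorem measurable_effSign (hy : Measurable y) : Measurable (effSign tp y o r r' T) := by
  have h := measurable_branchSwitching tp r hy
  have h' := measurable_branchSwitching tp r' hy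
  exact Measurable.ite measurableSet_Ioi (by fun_prop) (by fun_prop)

theorem continuousAt_effSign {S : Set ℝ} (hy : ∀ t, t ∉ S → ContinuousAt y t) {t : ℝ}
    (ht : t ∉ {0} ∪ ((fun t => T - t) ⁻¹' (Set.range tp ∪ S)
      ∪ (fun t => T + t) ⁻¹' (Set.range tp ∪ S))) :
    ContinuousAt (effSign tp y o r r' T) t := by
  simp only [Set.mem_union, Set.mem_singleton_iff, Set.mem_preimage, not_or] at ht
  obtain ⟨h0, ⟨h1, h1'⟩, h2, h2'⟩ := ht
  have hL : ContinuousAt (fun t => -(pauliSign o Axis.z * branchSwitching tp y r' (T - t))) t := by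
    refine (continuousAt_const.mul (ContinuousAt.comp
      (continuousAt_branchSwitching tp r' (hy _ h1') h1) ?_)).neg
    fun_prop
  have hR : ContinuousAt (fun t => branchSwitching tp y r (T + t)) t := by
    refine ContinuousAt.comp (continuousAt_branchSwitching tp r (hy _ h2') h2) ?_
    fun_prop
  rcases lt_or_gt_of_ne h0 with h | h
  · exact hR.congr ((gt_mem_nhds h).mono fun s hs => by simp [effSign, not_lt.2 hs.le])
  · exact hL.congr ((lt_mem_nhds h).mono fun s hs => by simp [effSign, hs])

theorem YPlus_add_YMinus (t : ℝ) :
    YPlus tp y o r r' t + YMinus tp y o r r' t = branchSwitching tp y r t := by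
  rw [YPlus, YMinus]
  ring

theorem YPlus_sub_YMinus (t : ℝ) : YPlus tp y o r r' t + -YMinus tp y o r r' t
    = pauliSign o Axis.z * branchSwitching tp y r' t := by
  rw [YPlus, YMinus]
  ring

/-- At each time exactly one of `Y⁺` and `Y⁻` vanishes, the other one being a sign. -/
theorem YPlus_YMinus_cases {t : ℝ} (hy : |y t| = 1) :
    (YPlus tp y o r r' t = 0 ∧ (YMinus tp y o r r' t = 1 ∨ YMinus tp y o r r' t = -1))
      ∨ (YMinus tp y o r r' t = 0 ∧ (YPlus tp y o r r' t = 1 ∨ YPlus tp y o r r' t = -1)) := by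
  have hp := abs_branchSwitching tp r hy
  have hq : |pauliSign o Axis.z * branchSwitching tp y r' t| = 1 := by
    rw [abs_pauliSign_mul, abs_branchSwitching tp r' hy]
  rw [YPlus, YMinus]
  rcases eq_or_eq_neg_of_abs_eq hp with h | h <;> rcases eq_or_eq_neg_of_abs_eq hq with h' | h' <;>
    rw [h, h'] <;> norm_num

end Switching

/-! ### Effective Hamiltonians of pairs of branches -/

section Effective

variable {E : Type*} [NormedAddCommGroup E] [InnerProductSpace ℂ E] [CompleteSpace E]
  {D : Submodule ℂ E} {X : ℝ → D →ₗ[ℂ] D} {y : ℝ → ℝ} {N : ℕ} {tp : Fin (N + 1) → ℝ}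
  {U : ℤˣ → ℝ → ℝ → JointOp E}

/-- The branch sign is constant inside each interval, so the propagator of that sign, started at the
left end, solves the equation there; `IsWeakSolution.chain` concatenates the pieces. -/
theorem exists_branch_solution (htp : StrictMono tp)
    (hU : ∀ ε : ℤˣ, IsTimeOrderedExp D X
      (fun t => ((((ε : ℤ) : ℝ) * y t : ℝ) : ℂ) • pauli Axis.z) (tp 0) (tp (Fin.last N)) (U ε))
    (r : Fin (N + 1) → Fin 2) :
    ∃ L, IsWeakSolution D X (fun t => (branchSwitching tp y r t : ℂ) • pauli Axis.z) (tp 0)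
        (tp (Fin.last N)) L
      ∧ (∀ t ∈ Set.Icc (tp 0) (tp (Fin.last N)), L t ∈ unitary (JointOp E))
      ∧ L (tp 0) = 1 ∧ L (tp (Fin.last N)) = branchPropagator tp U r := by
  refine IsWeakSolution.chain tp htp.monotone _ fun k => ?_
  have h0 : tp 0 ≤ tp k.castSucc := htp.monotone (Fin.zero_le _)
  have hk : tp k.castSucc ≤ tp k.succ := htp.monotone (Fin.castSucc_lt_succ).le
  have hl : tp k.succ ≤ tp (Fin.last N) := htp.monotone (Fin.le_last _)
  have hp := (hU ((-1) ^ tailWeight r k.succ)).propagator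
  have hs : tp k.castSucc ∈ Set.Icc (tp 0) (tp (Fin.last N)) := ⟨h0, hk.trans hl⟩
  refine ⟨fun t => U ((-1) ^ tailWeight r k.succ) t (tp k.castSucc), ?_, ?_, hp.self _ hs, rfl⟩
  · refine ((hp.isWeakSolution hs).mono (Set.Icc_subset_Icc h0 hl)).congr (fun _ _ => rfl)
      (fun u hu => ?_) fun _ _ => rfl
    rw [branchSwitching_of_mem_Ioo r htp k hu]
  · exact fun t ht => hp.mem_unitary _ hs t ⟨h0.trans ht.1, ht.2.trans hl⟩

/-- With S = σ_o and V = L'(T)† S L(T), the solution is L(T + t) for t ≤ 0 and S L'(T - t) V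
afterwards. The pieces agree at t = 0 because L'(T) L'(T)† = 1 and S² = 1, and at t = T what remains
is S V. Time reversal supplies the minus sign and conjugation by S the factor f_o^z. -/
theorem exists_echo_solution {T : ℝ} (hT : 0 ≤ T) (o : Axis) (r r' : Fin (N + 1) → Fin 2)
    {L L' : ℝ → JointOp E}
    (hL : IsWeakSolution D X (fun t => (branchSwitching tp y r t : ℂ) • pauli Axis.z) 0 T L)
    (hLu : ∀ t ∈ Set.Icc 0 T, L t ∈ unitary (JointOp E)) (hL0 : L 0 = 1)
    (hL' : IsWeakSolution D X (fun t => (branchSwitching tp y r' t : ℂ) • pauli Axis.z) 0 T L')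
    (hLu' : ∀ t ∈ Set.Icc 0 T, L' t ∈ unitary (JointOp E)) (hL0' : L' 0 = 1) :
    ∃ K, IsWeakSolution D (fun t => X (effTime T t))
        (fun t => (effSign tp y o r r' T t : ℂ) • pauli Axis.z) (-T) T K
      ∧ (∀ t ∈ Set.Icc (-T) T, K t ∈ unitary (JointOp E))
      ∧ K (-T) = 1 ∧ K T = echo o (L T) (L' T) := by
  have hTT : T ∈ Set.Icc 0 T := ⟨hT, le_rfl⟩
  set S := onQubit E (pauli o) with hS
  have hSS : S * S = 1 := onQubit_pauli_mul_self _
  have hSu : S ∈ unitary (JointOp E) := onQubit_pauli_mem_unitary _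
  set V := star (L' T) * S * L T with hV
  have hVu : V ∈ unitary (JointOp E) :=
    mul_mem (mul_mem (Unitary.star_mem (hLu' T hTT)) hSu) (hLu T hTT)
  have h1 : IsWeakSolution D (fun t => X (effTime T t))
      (fun t => (effSign tp y o r r' T t : ℂ) • pauli Axis.z) (-T) 0 (fun t => L (T + t)) := by
    have h := hL.shift T
    rw [zero_sub, sub_self] at h
    refine h.congr (fun u hu => ?_) (fun u hu => ?_) fun _ _ => rfl
    · rw [effTime, if_neg (not_lt.2 hu.2.le)]
    · rw [effSign, if_neg (not_lt.2 hu.2.le)]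
  have h2 : IsWeakSolution D (fun t => X (effTime T t))
      (fun t => (effSign tp y o r r' T t : ℂ) • pauli Axis.z) 0 T
      (fun t => S * L' (T - t) * V) := by
    have h := hL'.reflect T
    rw [sub_zero, sub_self] at h
    have h' := (h.conj (A' := fun t => ((-(pauliSign o Axis.z * branchSwitching tp y r' (T - t)) : ℝ)
      : ℂ) • pauli Axis.z) (pauli o) fun u => ?_).mul_right V
    · refine h'.congr (fun u hu => ?_) (fun u hu => ?_) fun _ _ => rfl
      · rw [effTime, if_pos hu.1]
      · rw [effSign, if_pos hu.1]
    · have hf : (pauliSign o Axis.z : ℂ) * (pauliSign o Axis.z : ℂ) = 1 := by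
        exact_mod_cast pauliSign_mul_self o Axis.z
      rw [mul_neg, mul_smul_comm, pauli_mul_pauli o Axis.z, smul_mul_assoc, smul_smul, ← neg_smul]
      push_cast
      congr 1
      ring
  have hglue : L (T + 0) = S * L' (T - 0) * V := by
    rw [add_zero, sub_zero, hV, mul_assoc S, ← mul_assoc (L' T), ← mul_assoc (L' T),
      (Unitary.mem_iff.1 (hLu' T hTT)).2, one_mul, ← mul_assoc, hSS, one_mul]
  refine ⟨_, h1.glue h2 (by linarith) hT hglue, fun t ht => ?_, ?_, ?_⟩
  · split_ifs with h
    · exact hLu _ ⟨by linarith [ht.1], by linarith⟩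
    · exact mul_mem (mul_mem hSu (hLu' _ ⟨by linarith [ht.2], by linarith⟩)) hVu
  · rw [if_pos (by linarith), add_neg_cancel, hL0]
  · have hecho : echo o (L T) (L' T) = S * L' (T - T) * V := by
      rw [sub_self, hL0', mul_one, echo, pauli_inv, hV]
      simp only [mul_assoc, hS]
    rw [hecho]
    split_ifs with h
    · have : T = 0 := le_antisymm h hT
      rw [this] at hglue ⊢
      exact hglue
    · rfl

end Effective

theorem exp_smul_one (z : ℂ) :
    NormedSpace.exp (z • (1 : Matrix (Fin 2) (Fin 2) ℂ)) = Complex.exp z • 1 := by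
  rw [← Matrix.diagonal_one, ← Matrix.diagonal_smul, Matrix.exp_diagonal, ← Matrix.diagonal_smul]
  congr 1
  rw [Pi.exp_def]
  ext i
  simp [Complex.exp_eq_exp_ℂ]

/-! ### Cumulants -/

namespace Bath

variable {Ω : Type*} [MeasurableSpace Ω] {P : Measure Ω} [IsProbabilityMeasure P] {H : Type*}
  [NormedAddCommGroup H] [InnerProductSpace ℂ H] {ι : Type*} (b : Bath P H ι) {N : ℕ}
  (tp : Fin (N + 1) → ℝ) {y : ℝ → ℝ} (o : Axis) (r r' : Fin (N + 1) → Fin 2) (T : ℝ)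

theorem cumulantOne_eq_zero (hmean : b.IsZeroMean) : b.cumulantOne tp y o r r' T = 0 := by
  ext i j
  simp [cumulantOne, hmean _]

theorem cumulantTwo_eq (hmean : b.IsZeroMean) : b.cumulantTwo tp y o r r' T
    = (2 * ∫ t in (-T)..T, ∫ u in (-T)..t, (effSign tp y o r r' T t : ℂ)
        * (effSign tp y o r r' T u : ℂ) * b.corr (effTime T t) (effTime T u)) • 1 := by
  rw [cumulantTwo, cumulantOne_eq_zero b tp o r r' T hmean]
  ext i j
  simp only [effCoupling_eq, smul_mul_smul_comm, pauli_mul_self, Matrix.smul_apply, Matrix.one_apply,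
    Matrix.sub_apply, Matrix.of_apply]
  split_ifs <;> simp

/-- Conjugation swaps the arguments of the two-point function (`conj_corr`), so its symmetric part
is real. The same argument makes the antisymmetric part imaginary in `re_IMinus`. -/
theorem im_IPlus : (b.IPlus tp y o r r' T).im = 0 := by
  have h : ∀ t t', b.corrPlus t t' = ((b.corrPlus t t').re : ℂ) := fun t t' => by
    rw [eq_comm, ← conj_eq_iff_re, corrPlus, map_add, ← RCLike.star_def, conj_corr, conj_corr,
      add_comm]
  have h' : b.IPlus tp y o r r' T = ((∫ t in (0 : ℝ)..T, ∫ t' in (0 : ℝ)..T,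
      YMinus tp y o r r' t * YMinus tp y o r r' t' * (b.corrPlus t t').re : ℝ) : ℂ) := by
    rw [IPlus, ← intervalIntegral.integral_ofReal]
    refine intervalIntegral.integral_congr fun t _ => ?_
    rw [← intervalIntegral.integral_ofReal]
    refine intervalIntegral.integral_congr fun t' _ => ?_
    rw [h]
    push_cast
    rfl
  rw [h', ofReal_im]

theorem re_IMinus : (b.IMinus tp y o r r' T).re = 0 := by
  have h : ∀ t t', b.corrMinus t t' = ((b.corrMinus t t').im : ℂ) * I := fun t t' => by
    have hre : (b.corrMinus t t').re = 0 := by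
      rw [corrMinus, ← b.conj_corr t t', sub_re]
      simp
    conv_lhs => rw [← re_add_im (b.corrMinus t t'), hre, ofReal_zero, zero_add]
  have h' : b.IMinus tp y o r r' T = ((∫ t in (0 : ℝ)..T, ∫ t' in (0 : ℝ)..t,
      YMinus tp y o r r' t * YPlus tp y o r r' t' * (b.corrMinus t t').im : ℝ) : ℂ) * I := by
    rw [IMinus, ← intervalIntegral.integral_ofReal, ← intervalIntegral.integral_mul_const]
    refine intervalIntegral.integral_congr fun t _ => ?_
    rw [← intervalIntegral.integral_ofReal, ← intervalIntegral.integral_mul_const]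
    refine intervalIntegral.integral_congr fun t' _ => ?_
    push_cast
    linear_combination
      ((YMinus tp y o r r' t : ℂ) * (YPlus tp y o r r' t' : ℂ)) * h t t'
  rw [h']
  simp

/-- The folding identity with p = y_r and q = f_o^z y_{r'}, for which the half sum w is Y⁺ and the
half difference m is Y⁻. -/
theorem integral_effSign_eq (hstat : b.IsStationary) (hcont : Continuous fun τ : ℝ => b.corr τ 0)
    (hy : ∀ t, |y t| = 1) (hym : Measurable y) (hT : 0 ≤ T) :
    ∫ t in (-T)..T, ∫ u in (-T)..t, (effSign tp y o r r' T t : ℂ)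
        * (effSign tp y o r r' T u : ℂ) * b.corr (effTime T t) (effTime T u)
      = b.IPlus tp y o r r' T + 2 * b.IMinus tp y o r r' T := by
  have hp := measurable_branchSwitching tp r hym
  have hq := measurable_branchSwitching tp r' hym
  have hw : Measurable (YPlus tp y o r r') := (hp.add (hq.const_mul _)).div_const 2
  have hm : Measurable (YMinus tp y o r r') := (hp.sub (hq.const_mul _)).div_const 2
  exact integral_effTime_eq_add (C := ‖b.corr 0 0‖) (b.continuous_corr hstat hcont)
    (b.norm_corr_le hstat) hT
    (p := fun t => (branchSwitching tp y r t : ℂ))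
    (q := fun t => ((pauliSign o Axis.z * branchSwitching tp y r' t : ℝ) : ℂ))
    (w := fun t => (YPlus tp y o r r' t : ℂ)) (m := fun t => (YMinus tp y o r r' t : ℂ))
    (by fun_prop) (fun t => by simp [abs_branchSwitching tp r (hy t)])
    (by fun_prop) (fun t => by
      rw [norm_real, Real.norm_eq_abs, abs_pauliSign_mul, abs_branchSwitching tp r' (hy t)])
    (by fun_prop) (fun t => by
      rcases YPlus_YMinus_cases tp r o r' (hy t) with ⟨h, -⟩ | ⟨-, h | h⟩ <;> simp [h])
    (by fun_prop) (fun t => by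
      rcases YPlus_YMinus_cases tp r o r' (hy t) with ⟨-, h | h⟩ | ⟨h, -⟩ <;> simp [h])
    (fun t => by exact_mod_cast (YPlus_add_YMinus tp r o r' t).symm)
    (fun t => by exact_mod_cast (YPlus_sub_YMinus tp r o r' t).symm)
    (fun t => by rw [effSign]; split_ifs <;> push_cast <;> rfl)

theorem vFun_eq : b.vFun tp y o r r' T
    = Complex.exp (-(b.IPlus tp y o r r' T + 2 * b.IMinus tp y o r r' T)) := by
  rw [vFun]
  congr 1
  conv_rhs => rw [← re_add_im (b.IMinus tp y o r r' T), re_IMinus, ofReal_zero, zero_add]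
  ring

end Bath

end Dephasing

end

/-! ### Assembly of the main theorem. -/

open Dephasing in
theorem mainTheorem2 {Ω : Type*} [MeasurableSpace Ω] (P : Measure Ω) [IsProbabilityMeasure P]
    {H : Type*} [NormedAddCommGroup H] [InnerProductSpace ℂ H] [CompleteSpace H] {ι : Type*}
    (b : Bath P H ι) (hmean : b.IsZeroMean) (hgauss : b.IsGaussian) (hstat : b.IsStationary)
    (hcont : Continuous fun τ : ℝ => b.corr τ 0)
    (pulses : Finset ℝ) (y : ℝ → ℝ) (hy : y = switching pulses)
    (N : ℕ) (tp θ : Fin (N + 1) → ℝ) (T : ℝ) (htp : StrictMono tp) (h0 : tp 0 = 0)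
    (hT : tp (Fin.last N) = T)
    (U : ℤˣ → ℝ → ℝ → JointOp (BathSpace P H))
    (hU : ∀ ε : ℤˣ, IsTimeOrderedExp b.dom b.B
      (fun t => ((((ε : ℤ) : ℝ) * y t : ℝ) : ℂ) • pauli Axis.z) 0 T (U ε))
    (ρS : Matrix (Fin 2) (Fin 2) ℂ) (hρ : ρS.PosSemidef) (hρ1 : ρS.trace = 1) :
    -- the toggling frame of the π pulses
    (∀ t, (piControl pulses t)ᴴ * pauli Axis.z * piControl pulses t
        = ((y t : ℝ) : ℂ) • pauli Axis.z)
    ∧ (∀ t α, (piControl pulses t)ᴴ * yRotation α * piControl pulses t = yRotation α)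
    -- expansion of the propagator over branches
    ∧ totalPropagator tp θ (U 1)
        = ∑ r : Fin (N + 1) → Fin 2,
            ((∏ j, (rotCoeff (θ j) (r j) : ℂ)) * I ^ tailWeight r 0) •
              (branchPropagator tp U r
                * onQubit (BathSpace P H) (pauli Axis.y ^ tailWeight r 0))
    ∧ (∀ (o : Axis),
      -- expansion of `V_O(T)` over pairs of branches
      b.reduce (echo o (totalPropagator tp θ (U 1)) (totalPropagator tp θ (U 1)))
        = ∑ r : Fin (N + 1) → Fin 2, ∑ r' : Fin (N + 1) → Fin 2,
            (I ^ ((tailWeight r 0 : ℤ) - (tailWeight r' 0 : ℤ))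
              * (∏ j, (rotCoeff (θ j) (r' j) : ℂ) * (rotCoeff (θ j) (r j) : ℂ))
              * (pauliSign o Axis.y : ℂ) ^ tailWeight r' 0) •
              (pauli Axis.y ^ tailWeight r' 0
                * b.reduce (echo o (branchPropagator tp U r) (branchPropagator tp U r'))
                * pauli Axis.y ^ tailWeight r 0)
      ∧ (∀ r r' : Fin (N + 1) → Fin 2,
        -- time-ordered exponential of the effective Hamiltonian on `[-T, T]`
        (∃ W : ℝ → ℝ → JointOp (BathSpace P H),
          IsPropagator b.dom (fun t => b.B (effTime T t)) (effCoupling tp y o r r' T) (-T) T W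
          ∧ echo o (branchPropagator tp U r) (branchPropagator tp U r') = W T (-T))
        -- exact truncation of the cumulant expansion
        ∧ b.reduce (echo o (branchPropagator tp U r) (branchPropagator tp U r'))
          = NormedSpace.exp (-I • b.cumulantOne tp y o r r' T
              - (1 / 2 : ℂ) • b.cumulantTwo tp y o r r' T)
        -- the two cumulants
        ∧ b.cumulantOne tp y o r r' T
          = (2 * ∫ t in (0 : ℝ)..T, (YMinus tp y o r r' t : ℂ) * b.moment [t]) • pauli Axis.z
        ∧ b.cumulantOne tp y o r r' T = 0
        ∧ b.cumulantTwo tp y o r r' T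
          = (2 * b.IPlus tp y o r r' T + 4 * b.IMinus tp y o r r' T) • 1
        ∧ (b.IPlus tp y o r r' T).im = 0
        ∧ (b.IMinus tp y o r r' T).re = 0
        ∧ b.reduce (echo o (branchPropagator tp U r) (branchPropagator tp U r'))
          = b.vFun tp y o r r' T • 1
        -- incompatibility condition
        ∧ (∀ t ∈ Set.Icc 0 T,
            |YPlus tp y o r r' t + YMinus tp y o r r' t| = 1
            ∧ YPlus tp y o r r' t * YMinus tp y o r r' t = 0
            ∧ YPlus tp y o r r' t ∈ ({-1, 0, 1} : Set ℝ)
            ∧ YMinus tp y o r r' t ∈ ({-1, 0, 1} : Set ℝ)))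
      -- expectation values of the observables
      ∧ (b.reducedState (totalPropagator tp θ (U 1)) ρS * pauli o).trace
        = (b.reduce (echo o (totalPropagator tp θ (U 1)) (totalPropagator tp θ (U 1)))
            * ρS * pauli o).trace
      ∧ (b.reducedState (totalPropagator tp θ (U 1)) ρS * pauli o).trace
        = ∑ r : Fin (N + 1) → Fin 2, ∑ r' : Fin (N + 1) → Fin 2,
            (I ^ ((tailWeight r 0 : ℤ) - (tailWeight r' 0 : ℤ))
              * (∏ j, (rotCoeff (θ j) (r' j) : ℂ) * (rotCoeff (θ j) (r j) : ℂ))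
              * (pauliSign o Axis.y : ℂ) ^ tailWeight r' 0
              * (pauli Axis.y ^ tailWeight r' 0 * pauli Axis.y ^ tailWeight r 0
                  * ρS * pauli o).trace)
              * b.vFun tp y o r r' T)
    -- the reduced state is determined by these expectation values
    ∧ b.reducedState (totalPropagator tp θ (U 1)) ρS
        = (1 / 2 : ℂ) • (1
          + (b.reducedState (totalPropagator tp θ (U 1)) ρS * pauli Axis.x).trace • pauli Axis.x
          + (b.reducedState (totalPropagator tp θ (U 1)) ρS * pauli Axis.y).trace • pauli Axis.y
          + (b.reducedState (totalPropagator tp θ (U 1)) ρS * pauli Axis.z).trace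
              • pauli Axis.z) := by
  subst hy
  have hTpos : 0 ≤ T := by
    rw [← h0, ← hT]
    exact htp.monotone (Fin.zero_le _)
  have hU' := hU
  rw [← h0, ← hT] at hU'
  have hyabs := abs_switching pulses
  have hym := measurable_switching pulses
  have hexp := totalPropagator_eq_sum θ htp.monotone hU'
  have hUu : totalPropagator tp θ (U 1) ∈ unitary (JointOp (BathSpace P H)) := by
    refine mul_mem (list_reverse_prod_mem_unitary fun k => mul_mem
      (onQubit_yRotation_mem_unitary _) ?_) (onQubit_yRotation_mem_unitary _)
    exact (hU' 1).propagator.mem_unitary _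
      ⟨htp.monotone (Fin.zero_le _), htp.monotone (Fin.le_last _)⟩ _
      ⟨htp.monotone (Fin.zero_le _), htp.monotone (Fin.le_last _)⟩
  have hsol := fun r => exists_branch_solution htp hU' r
  rw [h0, hT] at hsol
  -- The effective coupling can jump only at the fold t = 0 and where T - t or T + t meets a pulse
  -- time, a finite set.
  have hS : ({0} ∪ ((fun t => T - t) ⁻¹' (Set.range tp ∪ (pulses : Set ℝ))
      ∪ (fun t => T + t) ⁻¹' (Set.range tp ∪ (pulses : Set ℝ)))).Countable := by
    have hf : (Set.range tp ∪ (pulses : Set ℝ)).Finite :=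
      (Set.finite_range tp).union pulses.finite_toSet
    exact ((Set.finite_singleton 0).union ((hf.preimage (sub_right_injective.injOn)).union
      (hf.preimage ((add_right_injective T).injOn)))).countable
  -- One and the same solution K on [-T, T] yields both the propagator and the closed form of its
  -- expectation.
  have hpair : ∀ o r r', (∃ W : ℝ → ℝ → JointOp (BathSpace P H),
        IsPropagator b.dom (fun t => b.B (effTime T t))
          (effCoupling tp (switching pulses) o r r' T) (-T) T W
        ∧ echo o (branchPropagator tp U r) (branchPropagator tp U r') = W T (-T))
      ∧ b.reduce (echo o (branchPropagator tp U r) (branchPropagator tp U r'))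
        = b.vFun tp (switching pulses) o r r' T • 1 := by
    intro o r r'
    obtain ⟨L, hL, hLu, hL0, hLT⟩ := hsol r
    obtain ⟨L', hL', hLu', hL0', hLT'⟩ := hsol r'
    obtain ⟨K, hK, hKu, hK0, hKT⟩ :=
      exists_echo_solution hTpos o r r' hL hLu hL0 hL' hLu' hL0'
    rw [hLT, hLT'] at hKT
    constructor
    · refine ⟨fun t s => K t * star (K s), ?_, ?_⟩
      · rw [show effCoupling tp (switching pulses) o r r' T = _ from
          funext (effCoupling_eq tp r o r' T)]
        exact hK.isPropagator hKu
      · change _ = K T * star (K (-T))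
        rw [hK0, star_one, mul_one, hKT]
    · rw [← hKT, b.reduce_eq_exp hgauss hstat hcont (by linarith) (continuous_effTime T)
        (fun u => (abs_effSign tp r o r' T hyabs u).le) (measurable_effSign tp r o r' T hym) hS
        (fun u hu => continuousAt_effSign tp r o r' T
          (fun t ht => continuousAt_switching pulses ht) hu) hK hKu hK0,
        b.integral_effSign_eq tp o r r' T hstat hcont hyabs hym hTpos, b.vFun_eq]
  have hVo := fun o => b.reduce_echo_eq_sum o
    (fun r : Fin (N + 1) → Fin 2 => ∏ j, rotCoeff (θ j) (r j)) (fun r => tailWeight r 0)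
    (branchPropagator tp U) (U := totalPropagator tp θ (U 1)) (by simpa using hexp)
  simp only [ofReal_prod, ← Finset.prod_mul_distrib] at hVo
  refine ⟨piControl_conj_pauli_z pulses, piControl_conj_yRotation pulses, hexp,
    fun o => ⟨hVo o, fun r r' => ?_, b.trace_reducedState_mul_pauli _ ρS o, ?_⟩, ?_⟩
  · have h1 := b.cumulantOne_eq_zero tp o r r' T (y := switching pulses) hmean
    have h2 : b.cumulantTwo tp (switching pulses) o r r' T
        = (2 * b.IPlus tp (switching pulses) o r r' T
          + 4 * b.IMinus tp (switching pulses) o r r' T) • 1 := by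
      rw [b.cumulantTwo_eq tp o r r' T hmean,
        b.integral_effSign_eq tp o r r' T hstat hcont hyabs hym hTpos]
      congr 1
      ring
    refine ⟨(hpair o r r').1, ?_, ?_, h1, h2, b.im_IPlus tp o r r' T, b.re_IMinus tp o r r' T,
      (hpair o r r').2, fun t _ => ?_⟩
    · rw [(hpair o r r').2, h1, h2, smul_zero, zero_sub, smul_smul, ← neg_smul, exp_smul_one,
        b.vFun_eq]
      congr 2
      ring
    · rw [h1]
      simp [hmean _]
    · refine ⟨?_, ?_, ?_, ?_⟩
      · rw [YPlus_add_YMinus, abs_branchSwitching tp r (hyabs t)]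
      all_goals
        rcases YPlus_YMinus_cases tp r o r' (hyabs t) with ⟨h, h' | h'⟩ | ⟨h, h' | h'⟩ <;>
          simp [h, h']
  · rw [b.trace_reducedState_mul_pauli, hVo o, Finset.sum_mul, Finset.sum_mul, Matrix.trace_sum]
    refine Finset.sum_congr rfl fun r _ => ?_
    rw [Finset.sum_mul, Finset.sum_mul, Matrix.trace_sum]
    refine Finset.sum_congr rfl fun r' _ => ?_
    rw [(hpair o r r').2, mul_smul_comm, mul_one]
    simp only [smul_mul_assoc, Matrix.trace_smul, smul_eq_mul]
    ring
  · exact Bath.eq_pauli_expansion ((b.trace_reducedState hUu ρS).trans hρ1)
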